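/- Let $\lambda>0$, $b>0$, $c_2<c_1$, $\delta>0$, $r\in(0,1]$. Let $(N_t)_{t\ge0}$ be a Poisson process of rate $\lambda$ and, independent of it, let $X_1,X_2,\dots$ be i.i.d. non-negative claims with density $f$, distribution function $F$ and $EX_1<\infty$; put $\bar F=1-F$, $S(t)=\sum_{i=1}^{N_t}X_i$, and assume $c_2>\lambda EX_1$. For $u\ge0$ let $U(t)=u+c_1t-S(t)$ be the classical risk process, and let $U_b$ be the refracted process with $U_b(0)=u$, $dU_b(t)=c_1\,dt-dS(t)$ while $U_b(t)\le b$ and $dU_b(t)=c_2\,dt-dS(t)$ while $U_b(t)>b$. For either process let $\tau$ be its ruin time, i.e. the infimum of the times $t>0$ at which the process is negative, and let $$E\big[r^{N_\tau}e^{-\delta\tau}\mathbb 1(\tau<\infty)\big]$$ be its ruin transform; denote the ruin transform of $U_b$ started from $u\in[0,b]$ by $\phi_1(u)$. For $i=1,2$ let $\rho_i$ be the positive root of $c_is-(\lambda+\delta)+\lambda r\hat f(s)=0$, where $\hat f(s)=\int_0^\infty e^{-sx}f(x)\,dx$. Write $T_sg(x)=\int_x^\infty e^{-s(y-x)}g(y)\,dy$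 and $(g*h)(t)=\int_0^tg(x)h(t-x)\,dx$; $g^{n*}$ is the $n$-fold convolution, with $g^{0*}*h=h$. For $u\ge0$ set $$\phi_\infty(u)=\sum_{n=0}^\infty\Big(\frac{\lambda r}{c_1}\Big)^{n+1}(T_{\rho_1}f)^{n*}*T_{\rho_1}\bar F(u),\qquad \nu(u)=\sum_{n=0}^\infty\Big(\frac{\lambda r}{c_1}\Big)^{n}(T_{\rho_1}f)^{n*}*p(u),\quad p(x)=e^{\rho_1x}.$$ Then both series converge for every $u\ge0$; $\phi_\infty(u)$ is, for every $u\ge 0$, the ruin transform of the classical process $U$ started from $u$; the denominator below is non-zero; and for all $0\le u\le b$ $$\phi_1(u)=\phi_\infty(u)+\frac{\frac{\lambda r}{c_2}\big[\phi_\infty*T_{\rho_2}f(b)+T_{\rho_2}\bar F(b)\big]-\phi_\infty(b)}{\nu(b)-\frac{\lambda r}{c_2}\,\nu*T_{\rho_2}f(b)}\;\nu(u).$$ -/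

import Mathlib

open MeasureTheory ProbabilityTheory Set

namespace RiskModel

noncomputable section

/-! ### Paths of the risk processes

Here `w` is the sequence of inter-arrival times (`w 0` is the time of the first claim) and `x` the
sequence of claim sizes. -/

/-- Time of the `n`-th claim (`0` for `n = 0`). -/
def arrivalTime (w : ℕ → ℝ) (n : ℕ) : ℝ := ∑ i ∈ Finset.range n, w i

/-- The counting process `N_t`: the number of claims that arrive up to and including time `t`. -/
def claimCount (w : ℕ → ℝ) (t : ℝ) : ℕ := {n : ℕ | arrivalTime w (n + 1) ≤ t}.ncard

/-- The aggregate claim amount `S(t) = ∑_{i = 1}^{N_t} X_i`. -/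
def aggregateClaims (w x : ℕ → ℝ) (t : ℝ) : ℝ := ∑ i ∈ Finset.range (claimCount w t), x i

/-- The classical risk process `U(t) = u + c t - S(t)`. -/
def classicalSurplus (c u : ℝ) (w x : ℕ → ℝ) (t : ℝ) : ℝ := u + c * t - aggregateClaims w x t

/-- The drift of the refracted process: `c₁` up to the level `b`, `c₂` above it. -/
def driftRate (b c₁ c₂ y : ℝ) : ℝ := if y ≤ b then c₁ else c₂

/-- The surplus at time `t`, started from `y`, as long as no claim occurs: it grows at rate `c₁`
until it reaches `b` and at rate `c₂` afterwards. -/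
def driftFlow (b c₁ c₂ y t : ℝ) : ℝ :=
  if y ≤ b then
    if t ≤ (b - y) / c₁ then y + c₁ * t else b + c₂ * (t - (b - y) / c₁)
  else y + c₂ * t

/-- The refracted surplus immediately after the `n`-th claim (the initial capital for `n = 0`). -/
def postClaimSurplus (b c₁ c₂ u : ℝ) (w x : ℕ → ℝ) : ℕ → ℝ
  | 0 => u
  | n + 1 => driftFlow b c₁ c₂ (postClaimSurplus b c₁ c₂ u w x n) (w n) - x n

/-- The refracted risk process `U_b(t)` with `U_b(0) = u`. It follows the drift between claims and
jumps down by `x n` at the claims; `refractedSurplus_eq` below shows that it solves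
`dU_b(t) = c₁ dt - dS(t)` where `U_b(t) ≤ b`, `dU_b(t) = c₂ dt - dS(t)` where `U_b(t) > b`. -/
def refractedSurplus (b c₁ c₂ u : ℝ) (w x : ℕ → ℝ) (t : ℝ) : ℝ :=
  driftFlow b c₁ c₂ (postClaimSurplus b c₁ c₂ u w x (claimCount w t))
    (t - arrivalTime w (claimCount w t))

theorem arrivalTime_succ (w : ℕ → ℝ) (n : ℕ) :
    arrivalTime w (n + 1) = arrivalTime w n + w n := by
  simp [arrivalTime, Finset.sum_range_succ]

theorem claimCount_eq {w : ℕ → ℝ} (hw : ∀ n, 0 < w n) {n : ℕ} {t : ℝ}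
    (h1 : arrivalTime w n ≤ t) (h2 : t < arrivalTime w (n + 1)) : claimCount w t = n := by
  have hmono : StrictMono (arrivalTime w) :=
    strictMono_nat_of_lt_succ fun n => by rw [arrivalTime_succ]; linarith [hw n]
  have : {k : ℕ | arrivalTime w (k + 1) ≤ t} = Iio n := by
    ext k
    simp only [mem_ofPred_eq, mem_Iio]
    constructor
    · intro h
      have := hmono.lt_iff_lt.1 (lt_of_le_of_lt h h2)
      omega
    · intro h
      exact (hmono.monotone (Nat.succ_le_of_lt h)).trans h1
  rw [claimCount, this, ncard_Iio_nat]

theorem measurable_driftRate_driftFlow (b c₁ c₂ y : ℝ) :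
    Measurable fun s => driftRate b c₁ c₂ (driftFlow b c₁ c₂ y s) := by
  have h : Measurable (driftFlow b c₁ c₂ y) := by
    unfold driftFlow
    by_cases hy : y ≤ b
    · simp only [hy, if_true]
      exact Measurable.ite measurableSet_Iic (by fun_prop) (by fun_prop)
    · simp only [hy, if_false]
      fun_prop
  exact Measurable.ite (h measurableSet_Iic) measurable_const measurable_const

theorem intervalIntegrable_driftRate (b c₁ c₂ y p q : ℝ) :
    IntervalIntegrable (fun s => driftRate b c₁ c₂ (driftFlow b c₁ c₂ y s)) volume p q := by
  refine (intervalIntegrable_const (c := |c₁| + |c₂|)).mono_fun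
    (measurable_driftRate_driftFlow b c₁ c₂ y).aestronglyMeasurable (ae_of_all _ fun s => ?_)
  have h1 := abs_nonneg c₁
  have h2 := abs_nonneg c₂
  simp only [driftRate, Real.norm_eq_abs]
  rw [abs_of_nonneg (by positivity : 0 ≤ |c₁| + |c₂|)]
  split_ifs <;> linarith

theorem driftFlow_eq {b c₁ c₂ y t : ℝ} (h₁ : 0 < c₁) (h₂ : 0 < c₂) (ht : 0 ≤ t) :
    driftFlow b c₁ c₂ y t =
      y + ∫ s in (0 : ℝ)..t, driftRate b c₁ c₂ (driftFlow b c₁ c₂ y s) := by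
  by_cases hy : y ≤ b
  · have low : ∀ s, s ≤ (b - y) / c₁ → driftRate b c₁ c₂ (driftFlow b c₁ c₂ y s) = c₁ := by
      intro s hs
      have := (le_div_iff₀ h₁).1 hs
      simp only [driftRate, driftFlow, hy, hs, if_true]
      rw [if_pos (by linarith)]
    have high : ∀ s, (b - y) / c₁ < s → driftRate b c₁ c₂ (driftFlow b c₁ c₂ y s) = c₂ := by
      intro s hs
      simp only [driftRate, driftFlow, hy, if_true, not_le.2 hs, if_false]
      rw [if_neg]
      have : 0 < c₂ * (s - (b - y) / c₁) := mul_pos h₂ (by linarith)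
      linarith
    have hd : 0 ≤ (b - y) / c₁ := div_nonneg (by linarith) h₁.le
    by_cases htd : t ≤ (b - y) / c₁
    · rw [intervalIntegral.integral_congr_Ioo_of_le (g := fun _ => c₁) ht
        fun s hs => low s (hs.2.le.trans htd)]
      simp [driftFlow, hy, htd, mul_comm]
    · have htd' := (not_le.1 htd).le
      rw [← intervalIntegral.integral_add_adjacent_intervals
        (intervalIntegrable_driftRate b c₁ c₂ y 0 ((b - y) / c₁))
        (intervalIntegrable_driftRate b c₁ c₂ y ((b - y) / c₁) t),
        intervalIntegral.integral_congr_Ioo_of_le (g := fun _ => c₁) hd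
          fun s hs => low s hs.2.le,
        intervalIntegral.integral_congr_Ioo_of_le (g := fun _ => c₂) htd'
          fun s hs => high s hs.1]
      simp only [driftFlow, hy, htd, if_true, if_false, intervalIntegral.integral_const,
        smul_eq_mul]
      field_simp
      ring
  · rw [intervalIntegral.integral_congr_Ioo_of_le (g := fun _ => c₂) ht]
    · simp [driftFlow, hy, mul_comm]
    · intro s hs
      have : 0 < c₂ * s := mul_pos h₂ hs.1
      simp only [driftRate, driftFlow, hy, if_false]
      rw [if_neg (by linarith [not_le.1 hy])]

/-- The refracted process solves its defining equation
`U_b(t) = u + ∫₀ᵗ (c₁ 1{U_b(s) ≤ b} + c₂ 1{U_b(s) > b}) ds - S(t)`. -/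
theorem refractedSurplus_eq {b c₁ c₂ u : ℝ} {w : ℕ → ℝ} (x : ℕ → ℝ) (h₁ : 0 < c₁) (h₂ : 0 < c₂)
    (hw : ∀ n, 0 < w n) (hlim : ∀ t, ∃ n, t < arrivalTime w n) {t : ℝ} (ht : 0 ≤ t) :
    refractedSurplus b c₁ c₂ u w x t =
      u + (∫ s in (0 : ℝ)..t, driftRate b c₁ c₂ (refractedSurplus b c₁ c₂ u w x s))
        - aggregateClaims w x t := by
  set R : ℝ → ℝ := fun s => driftRate b c₁ c₂ (refractedSurplus b c₁ c₂ u w x s) with hR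
  -- on the `n`-th inter-arrival interval the process follows the drift
  have piece : ∀ n s, arrivalTime w n ≤ s → s < arrivalTime w (n + 1) →
      refractedSurplus b c₁ c₂ u w x s =
        driftFlow b c₁ c₂ (postClaimSurplus b c₁ c₂ u w x n) (s - arrivalTime w n) := by
    intro n s hs1 hs2
    rw [refractedSurplus, claimCount_eq hw hs1 hs2]
  have seg : ∀ n s, arrivalTime w n ≤ s → s ≤ arrivalTime w (n + 1) →
      IntervalIntegrable R volume (arrivalTime w n) s ∧
      ∫ v in (arrivalTime w n)..s, R v =
        driftFlow b c₁ c₂ (postClaimSurplus b c₁ c₂ u w x n) (s - arrivalTime w n)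
          - postClaimSurplus b c₁ c₂ u w x n := by
    intro n s hs1 hs2
    have heq : EqOn (fun v => driftRate b c₁ c₂ (driftFlow b c₁ c₂
        (postClaimSurplus b c₁ c₂ u w x n) (v - arrivalTime w n))) R
        (Ioo (arrivalTime w n) s) := by
      intro v hv
      simp only [hR]
      rw [piece n v hv.1.le (hv.2.trans_le hs2)]
    have hI := (intervalIntegrable_driftRate b c₁ c₂ (postClaimSurplus b c₁ c₂ u w x n)
      0 (s - arrivalTime w n)).comp_sub_right (arrivalTime w n)
    rw [zero_add, sub_add_cancel] at hI
    refine ⟨hI.congr_uIoo (by rwa [uIoo_of_le hs1]), ?_⟩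
    rw [← intervalIntegral.integral_congr_Ioo_of_le hs1 heq,
      intervalIntegral.integral_comp_sub_right (fun v => driftRate b c₁ c₂ (driftFlow b c₁ c₂
        (postClaimSurplus b c₁ c₂ u w x n) v)), sub_self,
      driftFlow_eq (t := s - arrivalTime w n) h₁ h₂ (by linarith)]
    ring
  have step : ∀ n, IntervalIntegrable R volume 0 (arrivalTime w n) ∧
      postClaimSurplus b c₁ c₂ u w x n =
        u + (∫ s in (0 : ℝ)..(arrivalTime w n), R s) - ∑ i ∈ Finset.range n, x i := by
    intro n
    induction n with
    | zero => simp [arrivalTime, postClaimSurplus]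
    | succ n ih =>
      have hle : arrivalTime w n ≤ arrivalTime w (n + 1) := by
        rw [arrivalTime_succ]; linarith [hw n]
      obtain ⟨hI, hv⟩ := seg n _ hle le_rfl
      refine ⟨ih.1.trans hI, ?_⟩
      rw [← intervalIntegral.integral_add_adjacent_intervals ih.1 hI, hv,
        Finset.sum_range_succ, arrivalTime_succ, add_sub_cancel_left]
      have := ih.2
      rw [postClaimSurplus]
      linarith
  -- the interval that contains `t`
  obtain ⟨n, hn1, hn2⟩ : ∃ n, arrivalTime w n ≤ t ∧ t < arrivalTime w (n + 1) := by
    classical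
    have hex := hlim t
    have hpos : Nat.find hex ≠ 0 := by
      intro h0
      have := Nat.find_spec hex
      rw [h0] at this
      simp only [arrivalTime, Finset.range_zero, Finset.sum_empty] at this
      linarith
    obtain ⟨n, hn⟩ := Nat.exists_eq_succ_of_ne_zero hpos
    refine ⟨n, not_lt.1 (Nat.find_min hex (by omega)), ?_⟩
    have := Nat.find_spec hex
    rwa [hn] at this
  obtain ⟨hI, hv⟩ := seg n t hn1 hn2.le
  rw [aggregateClaims, claimCount_eq hw hn1 hn2, piece n t hn1 hn2,
    ← intervalIntegral.integral_add_adjacent_intervals (step n).1 hI, hv]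
  linarith [(step n).2]

/-! ### Ruin -/

/-- The times `t > 0` at which the surplus path `U` is negative. -/
def ruinTimes (U : ℝ → ℝ) : Set ℝ := {t | 0 < t ∧ U t < 0}

open Classical in
/-- `r^{N_τ} e^{-δτ} 𝟙(τ < ∞)` for the path `U`, where `τ = inf {t > 0 : U(t) < 0}` and `N_τ` is the
number of claims up to and including time `τ`. -/
def ruinDiscount (r δ : ℝ) (w : ℕ → ℝ) (U : ℝ → ℝ) : ℝ :=
  if (ruinTimes U).Nonempty then
    r ^ claimCount w (sInf (ruinTimes U)) * Real.exp (-δ * sInf (ruinTimes U))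
  else 0

/-! ### Translation operator, convolutions, Lundberg equation -/

/-- The translation operator `T_s g(x) = ∫_x^∞ e^{-s(y-x)} g(y) dy`. -/
def translationOp (s : ℝ) (g : ℝ → ℝ) (x : ℝ) : ℝ :=
  ∫ y in Ioi x, Real.exp (-s * (y - x)) * g y

/-- The Laplace transform on the half-line. -/
def laplace (g : ℝ → ℝ) (s : ℝ) : ℝ := ∫ x in Ioi (0 : ℝ), Real.exp (-s * x) * g x

/-- The tail `1 - F(x)` of the distribution with density `f`. -/
def tail (f : ℝ → ℝ) (x : ℝ) : ℝ := 1 - ∫ y in Iic x, f y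

/-- `(g * h)(t) = ∫_0^t g(x) h(t - x) dx`. -/
def conv (g h : ℝ → ℝ) (t : ℝ) : ℝ := ∫ x in (0 : ℝ)..t, g x * h (t - x)

/-- `convPow g n` is the `(n + 1)`-fold convolution `g^{(n+1)*}`. -/
def convPow (g : ℝ → ℝ) : ℕ → ℝ → ℝ
  | 0 => g
  | n + 1 => conv g (convPow g n)

/-- `g^{n*} * h`, where `g^{0*}` is the unit point mass at `0`, so that `g^{0*} * h = h`. -/
def convPowConv (g h : ℝ → ℝ) : ℕ → ℝ → ℝ
  | 0 => h
  | n + 1 => conv (convPow g n) h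

/-- `ρ` is a positive root of the Lundberg equation `c s - (λ + δ) + λ r f̂(s) = 0`. -/
def IsPositiveLundbergRoot (c lam δ r : ℝ) (f : ℝ → ℝ) (ρ : ℝ) : Prop :=
  0 < ρ ∧ c * ρ - (lam + δ) + lam * r * laplace f ρ = 0

/-- The `n`-th term of the series for `φ_∞(u)`. -/
def phiInfTerm (c lam r ρ : ℝ) (f : ℝ → ℝ) (u : ℝ) (n : ℕ) : ℝ :=
  (lam * r / c) ^ (n + 1) * convPowConv (translationOp ρ f) (translationOp ρ (tail f)) n u

/-- `φ_∞(u) = ∑_{n ≥ 0} (λr/c)^{n+1} (T_ρ f)^{n*} * T_ρ F̄ (u)`. -/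
def phiInf (c lam r ρ : ℝ) (f : ℝ → ℝ) (u : ℝ) : ℝ := ∑' n, phiInfTerm c lam r ρ f u n

/-- The `n`-th term of the series for `ν(u)`. -/
def nuTerm (c lam r ρ : ℝ) (f : ℝ → ℝ) (u : ℝ) (n : ℕ) : ℝ :=
  (lam * r / c) ^ n * convPowConv (translationOp ρ f) (fun x => Real.exp (ρ * x)) n u

/-- `ν(u) = ∑_{n ≥ 0} (λr/c)^n (T_ρ f)^{n*} * p (u)` with `p(x) = e^{ρx}`. -/
def nu (c lam r ρ : ℝ) (f : ℝ → ℝ) (u : ℝ) : ℝ := ∑' n, nuTerm c lam r ρ f u n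

end

end RiskModel

namespace RiskModel

/-! Let `Φ` be the ruin transform of the refracted process, extended by `Φ = 1` on the negative
half-line, and put `G = Φ * f + tail f`, the mean of `Φ` after a claim. Conditioning on the first
claim expresses `Φ u` as a discounted integral of `G` along the drift. Where the premium rate is a
constant `c`, this becomes a linear integral equation with discount rate `κ = (λ+δ)/c`
(`exp_mul_eq_of_flow`).

Changing the rate from `κ` to the Lundberg root `ρ` cancels the Laplace factors. What remains is
that `exp (-ρ u) * D u` is constant along the stretch, where `D = Φ - (λr/c) (Φ * T_ρ f + T_ρ F̄)`
(`exp_mul_defect_eq`). Above `b` the stretch is unbounded and `D` grows at most linearly, so `D = 0`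
(`defect_eq_zero`). Below `b` one gets `D u = C exp (ρ₁ u)`, a Volterra equation whose only bounded
solution is `φ_∞ + C ν` (`eq_phiInf_add_nu`). Both descriptions hold at `b`, which gives a linear
equation for `C` and hence the formula. The classical process is the case of equal rates and level
`0`, where `C = 0`.

The denominator is positive because `ν` is nondecreasing and `ρ₂ ∫ T_{ρ₂} f ≤ 1 - f̂(ρ₂)`, so that
the Lundberg equation gives `(λr/c₂) ∫ T_{ρ₂} f < 1` (`denominator_pos`).

The probabilistic input is `IsRenewalModel.ruinTransform_eq`. Ruin within `n` claims obeys an exact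
recursion, its error is at most `exp (-δ T_n)` with `T_n` the time of the `n`-th claim, and almost
surely the claim times tend to infinity. -/

/-! ### Path decomposition at the first claim -/

/-- Inter-arrival times that are positive and add up to infinity. -/
def NonExplosive (w : ℕ → ℝ) : Prop := (∀ n, 0 < w n) ∧ ∀ t, ∃ n, t < arrivalTime w n

theorem arrivalTime_succ' (w : ℕ → ℝ) (n : ℕ) :
    arrivalTime w (n + 1) = w 0 + arrivalTime (fun i => w (i + 1)) n := by
  simp [arrivalTime, Finset.sum_range_succ', add_comm]

theorem arrivalTime_zero (w : ℕ → ℝ) : arrivalTime w 0 = 0 := by simp [arrivalTime]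

theorem NonExplosive.shift {w : ℕ → ℝ} (h : NonExplosive w) :
    NonExplosive fun i => w (i + 1) := by
  refine ⟨fun n => h.1 _, fun t => ?_⟩
  obtain ⟨n, hn⟩ := h.2 (w 0 + t)
  refine ⟨n, ?_⟩
  have h1 := arrivalTime_succ w n
  have h2 := arrivalTime_succ' w n
  have := h.1 n
  linarith

theorem NonExplosive.exists_interval {w : ℕ → ℝ} (h : NonExplosive w) {t : ℝ} (ht : 0 ≤ t) :
    ∃ n, arrivalTime w n ≤ t ∧ t < arrivalTime w (n + 1) := by
  classical
  have hex := h.2 t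
  have hpos : Nat.find hex ≠ 0 := by
    intro h0
    have := Nat.find_spec hex
    rw [h0, arrivalTime_zero] at this
    linarith
  obtain ⟨n, hn⟩ := Nat.exists_eq_succ_of_ne_zero hpos
  refine ⟨n, not_lt.1 (Nat.find_min hex (by omega)), ?_⟩
  have := Nat.find_spec hex
  rwa [hn] at this

theorem NonExplosive.claimCount_eq_zero {w : ℕ → ℝ} (h : NonExplosive w) {t : ℝ} (h0 : 0 ≤ t)
    (ht : t < w 0) : claimCount w t = 0 :=
  claimCount_eq h.1 (by rwa [arrivalTime_zero]) (by rwa [arrivalTime_succ, arrivalTime_zero, zero_add])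

theorem NonExplosive.claimCount_add {w : ℕ → ℝ} (h : NonExplosive w) {s : ℝ} (hs : 0 ≤ s) :
    claimCount w (w 0 + s) = claimCount (fun i => w (i + 1)) s + 1 := by
  obtain ⟨n, h1, h2⟩ := h.shift.exists_interval hs
  rw [claimCount_eq h.shift.1 h1 h2]
  exact claimCount_eq h.1 (by rw [arrivalTime_succ']; linarith) (by rw [arrivalTime_succ']; linarith)

/-- The defining recursion peels off the last claim. Conditioning on the first claim needs the first
one peeled off. -/
theorem postClaimSurplus_succ' (b c₁ c₂ u : ℝ) (w x : ℕ → ℝ) (n : ℕ) :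
    postClaimSurplus b c₁ c₂ u w x (n + 1) =
      postClaimSurplus b c₁ c₂ (driftFlow b c₁ c₂ u (w 0) - x 0)
        (fun i => w (i + 1)) (fun i => x (i + 1)) n := by
  induction n with
  | zero => rfl
  | succ n ih => rw [postClaimSurplus, ih]; rfl

theorem NonExplosive.refractedSurplus_of_lt {b c₁ c₂ u : ℝ} {w x : ℕ → ℝ} (h : NonExplosive w)
    {t : ℝ} (h0 : 0 ≤ t) (ht : t < w 0) :
    refractedSurplus b c₁ c₂ u w x t = driftFlow b c₁ c₂ u t := by
  rw [refractedSurplus, h.claimCount_eq_zero h0 ht, arrivalTime_zero, sub_zero, postClaimSurplus]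

theorem NonExplosive.refractedSurplus_add {b c₁ c₂ u : ℝ} {w x : ℕ → ℝ} (h : NonExplosive w)
    {s : ℝ} (hs : 0 ≤ s) :
    refractedSurplus b c₁ c₂ u w x (w 0 + s) =
      refractedSurplus b c₁ c₂ (driftFlow b c₁ c₂ u (w 0) - x 0)
        (fun i => w (i + 1)) (fun i => x (i + 1)) s := by
  rw [refractedSurplus, h.claimCount_add hs, postClaimSurplus_succ', arrivalTime_succ',
    refractedSurplus]
  congr 1
  ring

theorem le_driftFlow {b c₁ c₂ u t : ℝ} (h₁ : 0 < c₁) (h₂ : 0 < c₂) (ht : 0 ≤ t) :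
    u ≤ driftFlow b c₁ c₂ u t := by
  have e1 : 0 ≤ c₁ * t := by positivity
  have e2 : 0 ≤ c₂ * t := by positivity
  unfold driftFlow
  split_ifs with hu hc
  · linarith
  · have : 0 ≤ c₂ * (t - (b - u) / c₁) := mul_nonneg h₂.le (by linarith [not_le.1 hc])
    linarith
  · linarith

theorem driftFlow_of_le {b c₁ c₂ u t : ℝ} (h₁ : 0 < c₁) (hu : u + c₁ * t ≤ b) (ht : 0 ≤ t) :
    driftFlow b c₁ c₂ u t = u + c₁ * t := by
  have e1 : 0 ≤ c₁ * t := by positivity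
  unfold driftFlow
  rw [if_pos (by linarith), if_pos (by rw [le_div_iff₀ h₁]; linarith)]

theorem driftFlow_of_ge {b c₁ c₂ u t : ℝ} (hu : b ≤ u) (ht : 0 ≤ t) :
    driftFlow b c₁ c₂ u t = u + c₂ * t := by
  unfold driftFlow
  -- At `u = b` the definition takes its lower branch, with crossing time `0`.
  rcases hu.eq_or_lt with rfl | hu
  · rcases ht.eq_or_lt with rfl | ht
    · simp
    · simp [not_le.2 ht]
  · rw [if_neg (not_le.2 hu)]

/-- Flow property below `b`: the drift restarts at the level already reached. With its counterpart
above `b`, it lets the first-claim equations at two levels be compared. -/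
theorem driftFlow_add_of_le {b c₁ c₂ u s t : ℝ} (h₁ : 0 < c₁) (hu : u + c₁ * s ≤ b) (hs : 0 ≤ s) :
    driftFlow b c₁ c₂ u (s + t) = driftFlow b c₁ c₂ (u + c₁ * s) t := by
  have e1 : 0 ≤ c₁ * s := by positivity
  have e2 : (b - (u + c₁ * s)) / c₁ = (b - u) / c₁ - s := by field_simp; ring
  unfold driftFlow
  rw [if_pos (by linarith), if_pos hu, e2]
  by_cases h : s + t ≤ (b - u) / c₁
  · rw [if_pos h, if_pos (by linarith)]; ring
  · rw [if_neg h, if_neg (by linarith)]; ring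

theorem driftFlow_add_of_ge {b c₁ c₂ u s t : ℝ} (h₂ : 0 < c₂) (hu : b ≤ u) (hs : 0 ≤ s)
    (ht : 0 ≤ t) : driftFlow b c₁ c₂ u (s + t) = driftFlow b c₁ c₂ (u + c₂ * s) t := by
  have e1 : 0 ≤ c₂ * s := by positivity
  rw [driftFlow_of_ge hu (by linarith), driftFlow_of_ge (by linarith) ht]
  ring

theorem bddBelow_ruinTimes (U : ℝ → ℝ) : BddBelow (ruinTimes U) := ⟨0, fun _ h => h.1.le⟩

theorem sInf_ruinTimes_nonneg (U : ℝ → ℝ) : 0 ≤ sInf (ruinTimes U) :=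
  Real.sInf_nonneg fun _ h => h.1.le

theorem ruinDiscount_congr {r δ : ℝ} {w : ℕ → ℝ} {U V : ℝ → ℝ} (h : ∀ t, 0 < t → U t = V t) :
    ruinDiscount r δ w U = ruinDiscount r δ w V := by
  have : ruinTimes U = ruinTimes V := by
    ext t
    simp only [ruinTimes, mem_ofPred_eq]
    constructor <;> rintro ⟨h1, h2⟩
    · exact ⟨h1, by rwa [← h t h1]⟩
    · exact ⟨h1, by rwa [h t h1]⟩
  rw [ruinDiscount, ruinDiscount, this]

theorem ruinDiscount_nonneg {r δ : ℝ} (hr : 0 ≤ r) (w : ℕ → ℝ) (U : ℝ → ℝ) :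
    0 ≤ ruinDiscount r δ w U := by
  unfold ruinDiscount
  split_ifs
  · positivity
  · rfl

theorem ruinDiscount_le_one {r δ : ℝ} (hr : 0 ≤ r) (hr1 : r ≤ 1) (hδ : 0 ≤ δ) (w : ℕ → ℝ)
    (U : ℝ → ℝ) : ruinDiscount r δ w U ≤ 1 := by
  unfold ruinDiscount
  split_ifs
  · refine mul_le_one₀ (pow_le_one₀ hr hr1) (Real.exp_nonneg _) (Real.exp_le_one_iff.2 ?_)
    have := mul_nonneg hδ (sInf_ruinTimes_nonneg U)
    linarith
  · exact zero_le_one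

/-- Time `0` is not a ruin time, so the infimum `0` is only approached: the surplus stays negative
until it has climbed by `-u`, which takes time `-u / c₁`, or until the first claim. -/
theorem sInf_ruinTimes_of_neg {b c₁ c₂ u : ℝ} {w : ℕ → ℝ} (x : ℕ → ℝ) (h₁ : 0 < c₁) (hb : 0 ≤ b)
    (h : NonExplosive w) (hu : u < 0) :
    (ruinTimes (refractedSurplus b c₁ c₂ u w x)).Nonempty ∧
      sInf (ruinTimes (refractedSurplus b c₁ c₂ u w x)) = 0 := by
  have key : ∀ ε, 0 < ε → ∃ t ∈ ruinTimes (refractedSurplus b c₁ c₂ u w x), t < ε := by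
    intro ε hε
    have hd : 0 < -u / c₁ := div_pos (by linarith) h₁
    obtain ⟨t, ht0, ht⟩ := exists_between (lt_min hε (lt_min (h.1 0) hd))
    obtain ⟨ht1, ht2⟩ := lt_min_iff.1 ht
    obtain ⟨ht2, ht3⟩ := lt_min_iff.1 ht2
    rw [lt_div_iff₀ h₁] at ht3
    refine ⟨t, ⟨ht0, ?_⟩, ht1⟩
    rw [h.refractedSurplus_of_lt ht0.le ht2, driftFlow_of_le h₁ (by linarith) ht0.le]
    linarith
  refine ⟨(key 1 one_pos).imp fun _ h => h.1, le_antisymm ?_ (sInf_ruinTimes_nonneg _)⟩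
  refine le_of_forall_pos_lt_add fun ε hε => ?_
  obtain ⟨t, ht, hte⟩ := key ε hε
  linarith [csInf_le (bddBelow_ruinTimes _) ht]

theorem ruinDiscount_of_neg {b c₁ c₂ u r δ : ℝ} {w : ℕ → ℝ} (x : ℕ → ℝ) (h₁ : 0 < c₁)
    (hb : 0 ≤ b) (h : NonExplosive w) (hu : u < 0) :
    ruinDiscount r δ w (refractedSurplus b c₁ c₂ u w x) = 1 := by
  obtain ⟨hne, h0⟩ := sInf_ruinTimes_of_neg (c₂ := c₂) x h₁ hb h hu
  rw [ruinDiscount, if_pos hne, h0, h.claimCount_eq_zero le_rfl (h.1 0)]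
  simp

/-- Decomposition of the ruin discount at the first claim. -/
theorem ruinDiscount_of_nonneg {b c₁ c₂ u r δ : ℝ} {w : ℕ → ℝ} (x : ℕ → ℝ) (h₁ : 0 < c₁)
    (h₂ : 0 < c₂) (hb : 0 ≤ b) (h : NonExplosive w) (hu : 0 ≤ u) :
    ruinDiscount r δ w (refractedSurplus b c₁ c₂ u w x) =
      r * Real.exp (-δ * w 0) * ruinDiscount r δ (fun i => w (i + 1))
        (refractedSurplus b c₁ c₂ (driftFlow b c₁ c₂ u (w 0) - x 0)
          (fun i => w (i + 1)) (fun i => x (i + 1))) := by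
  set v := driftFlow b c₁ c₂ u (w 0) - x 0
  set U := refractedSurplus b c₁ c₂ u w x
  set V := refractedSurplus b c₁ c₂ v (fun i => w (i + 1)) (fun i => x (i + 1)) with hV
  have hw0 := h.1 0
  -- Time `s = 0` is allowed here although `ruinTimes V` excludes it: it is ruin caused by the first
  -- claim itself. Then `v < 0`, and the infimum for `V` is still `0`.
  have hmem : ∀ t, t ∈ ruinTimes U ↔ ∃ s, 0 ≤ s ∧ V s < 0 ∧ t = w 0 + s := by
    intro t
    constructor
    · rintro ⟨ht0, ht⟩
      have hle : w 0 ≤ t := by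
        by_contra hlt
        simp only [U, h.refractedSurplus_of_lt ht0.le (not_le.1 hlt)] at ht
        linarith [le_driftFlow (b := b) (u := u) h₁ h₂ ht0.le]
      have hUt := h.refractedSurplus_add (b := b) (c₁ := c₁) (c₂ := c₂) (u := u) (x := x)
        (sub_nonneg.2 hle)
      rw [add_sub_cancel] at hUt
      refine ⟨t - w 0, sub_nonneg.2 hle, ?_, by ring⟩
      rwa [hV, ← hUt]
    · rintro ⟨s, hs, hVs, rfl⟩
      refine ⟨by linarith, ?_⟩
      simp only [U]
      rwa [h.refractedSurplus_add hs]
  have key : (ruinTimes U).Nonempty ↔ (ruinTimes V).Nonempty := by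
    constructor
    · rintro ⟨t, ht⟩
      obtain ⟨s, hs, hVs, rfl⟩ := (hmem t).1 ht
      rcases hs.eq_or_lt with rfl | hs
      · have hv0 : v < 0 := by
          rw [hV, h.shift.refractedSurplus_of_lt le_rfl (h.1 1)] at hVs
          exact (le_driftFlow h₁ h₂ le_rfl).trans_lt hVs
        exact (sInf_ruinTimes_of_neg _ h₁ hb h.shift hv0).1
      · exact ⟨s, hs, hVs⟩
    · rintro ⟨s, hs, hVs⟩
      exact ⟨w 0 + s, (hmem _).2 ⟨s, hs.le, hVs, rfl⟩⟩
  unfold ruinDiscount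
  by_cases hne : (ruinTimes V).Nonempty
  · have hinf : sInf (ruinTimes U) = w 0 + sInf (ruinTimes V) := by
      refine le_antisymm ?_ (le_csInf (key.2 hne) fun t ht => ?_)
      · rw [← sub_le_iff_le_add']
        refine le_csInf hne fun s hs => ?_
        rw [sub_le_iff_le_add']
        exact csInf_le (bddBelow_ruinTimes _) ((hmem _).2 ⟨s, hs.1.le, hs.2, rfl⟩)
      · obtain ⟨s, hs, hVs, rfl⟩ := (hmem t).1 ht
        rcases hs.eq_or_lt with rfl | hs
        · have hv0 : v < 0 := by
            rw [hV, h.shift.refractedSurplus_of_lt le_rfl (h.1 1)] at hVs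
            exact (le_driftFlow h₁ h₂ le_rfl).trans_lt hVs
          linarith [(sInf_ruinTimes_of_neg (c₂ := c₂) (fun i => x (i + 1)) h₁ hb h.shift hv0).2]
        · linarith [csInf_le (bddBelow_ruinTimes V) (show s ∈ ruinTimes V from ⟨hs, hVs⟩)]
    rw [if_pos hne, if_pos (key.2 hne), hinf, h.claimCount_add (sInf_ruinTimes_nonneg _), mul_add,
      Real.exp_add, pow_succ]
    ring
  · rw [if_neg hne, if_neg (by rwa [key]), mul_zero]

/-- The classical surplus is the refracted one with equal premium rates. -/
theorem NonExplosive.classicalSurplus_eq {w : ℕ → ℝ} (x : ℕ → ℝ) (h : NonExplosive w) (b : ℝ)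
    {c : ℝ} (hc : 0 < c) (u : ℝ) {t : ℝ} (ht : 0 ≤ t) :
    classicalSurplus c u w x t = refractedSurplus b c c u w x t := by
  rw [refractedSurplus_eq x hc hc h.1 h.2 ht, classicalSurplus]
  simp [driftRate, mul_comm]

/-! ### Approximation by ruin within finitely many claims -/

/-- The discount of ruin within the first `n` claims. -/
noncomputable def ruinWithin (b c₁ c₂ r δ : ℝ) : ℕ → ℝ → (ℕ → ℝ) → (ℕ → ℝ) → ℝ
  | 0, u, _, _ => if u < 0 then 1 else 0
  | n + 1, u, w, x => if u < 0 then 1 else r * Real.exp (-δ * w 0) *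
      ruinWithin b c₁ c₂ r δ n (driftFlow b c₁ c₂ u (w 0) - x 0)
        (fun i => w (i + 1)) (fun i => x (i + 1))

/-- Both quantities obey the same first-claim recursion, so each claim multiplies the error by `r *
exp (-δ * w 0) ≤ exp (-δ * w 0)`, starting from an error of at most `1`. -/
theorem abs_ruinDiscount_sub_ruinWithin_le {b c₁ c₂ r δ : ℝ} (h₁ : 0 < c₁) (h₂ : 0 < c₂)
    (hb : 0 ≤ b) (hr : 0 ≤ r) (hr1 : r ≤ 1) (hδ : 0 ≤ δ) (n : ℕ) (u : ℝ) (w x : ℕ → ℝ)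
    (h : NonExplosive w) :
    |ruinDiscount r δ w (refractedSurplus b c₁ c₂ u w x) - ruinWithin b c₁ c₂ r δ n u w x| ≤
      Real.exp (-δ * arrivalTime w n) := by
  induction n generalizing u w x with
  | zero =>
    rw [ruinWithin, arrivalTime_zero, mul_zero, Real.exp_zero]
    split_ifs with hu
    · rw [ruinDiscount_of_neg x h₁ hb h hu]; simp
    · rw [sub_zero, abs_of_nonneg (ruinDiscount_nonneg hr _ _)]
      exact ruinDiscount_le_one hr hr1 hδ _ _
  | succ n ih =>
    rw [ruinWithin]
    split_ifs with hu
    · rw [ruinDiscount_of_neg x h₁ hb h hu, sub_self, abs_zero]; positivity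
    · rw [ruinDiscount_of_nonneg x h₁ h₂ hb h (not_lt.1 hu), ← mul_sub, abs_mul,
        abs_of_nonneg (by positivity), arrivalTime_succ', mul_add, Real.exp_add]
      gcongr
      · exact mul_le_of_le_one_left (Real.exp_nonneg _) hr1
      · exact ih _ _ _ h.shift

theorem NonExplosive.tendsto_ruinWithin {b c₁ c₂ r δ : ℝ} (h₁ : 0 < c₁) (h₂ : 0 < c₂)
    (hb : 0 ≤ b) (hr : 0 ≤ r) (hr1 : r ≤ 1) (hδ : 0 < δ) (u : ℝ) {w : ℕ → ℝ} (x : ℕ → ℝ)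
    (h : NonExplosive w) :
    Filter.Tendsto (fun n => ruinWithin b c₁ c₂ r δ n u w x) Filter.atTop
      (nhds (ruinDiscount r δ w (refractedSurplus b c₁ c₂ u w x))) := by
  have hT : Filter.Tendsto (arrivalTime w) Filter.atTop Filter.atTop := by
    refine Filter.tendsto_atTop_atTop_of_monotone (monotone_nat_of_le_succ fun n => ?_)
      fun t => (h.2 t).imp fun _ => le_of_lt
    rw [arrivalTime_succ]; linarith [h.1 n]
  have hE : Filter.Tendsto (fun n => Real.exp (-δ * arrivalTime w n)) Filter.atTop (nhds 0) :=
    Real.tendsto_exp_atBot.comp (hT.const_mul_atTop_of_neg (neg_lt_zero.2 hδ))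
  rw [tendsto_iff_dist_tendsto_zero]
  refine squeeze_zero (fun _ => dist_nonneg) (fun n => ?_) hE
  rw [dist_comm, Real.dist_eq]
  exact abs_ruinDiscount_sub_ruinWithin_le h₁ h₂ hb hr hr1 hδ.le n u w x h

theorem ruinWithin_nonneg_le_one {b c₁ c₂ r δ : ℝ} (hr : 0 ≤ r) (hr1 : r ≤ 1) (hδ : 0 ≤ δ)
    (n : ℕ) (u : ℝ) (w x : ℕ → ℝ) (hw : ∀ i, 0 ≤ w i) :
    0 ≤ ruinWithin b c₁ c₂ r δ n u w x ∧ ruinWithin b c₁ c₂ r δ n u w x ≤ 1 := by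
  induction n generalizing u w x with
  | zero => rw [ruinWithin]; split_ifs <;> norm_num
  | succ n ih =>
    rw [ruinWithin]
    split_ifs
    · norm_num
    · obtain ⟨h0, h1⟩ := ih (driftFlow b c₁ c₂ u (w 0) - x 0) (fun i => w (i + 1))
        (fun i => x (i + 1)) fun i => hw _
      have : Real.exp (-δ * w 0) ≤ 1 := Real.exp_le_one_iff.2 (by nlinarith [hw 0])
      exact ⟨by positivity, mul_le_one₀ (mul_le_one₀ hr1 (Real.exp_nonneg _) this) h0 h1⟩

/-! ### The first-claim equation of the ruin transform -/

/-- Independent inter-arrival times with law `m` and claims with law `μ`. -/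
structure IsRenewalModel {Ω : Type*} [MeasurableSpace Ω] (P : Measure Ω) (m μ : Measure ℝ)
    (W X : ℕ → Ω → ℝ) : Prop where
  meas_W : ∀ i, Measurable (W i)
  meas_X : ∀ i, Measurable (X i)
  map_W : ∀ i, P.map (W i) = m
  map_X : ∀ i, P.map (X i) = μ
  indep : iIndepFun (Sum.elim W X : ℕ ⊕ ℕ → Ω → ℝ) P

section

variable {Ω : Type*} [MeasurableSpace Ω] {P : Measure Ω} {m μ : Measure ℝ} {W X : ℕ → Ω → ℝ}

theorem IsRenewalModel.meas (h : IsRenewalModel P m μ W X) (i : ℕ ⊕ ℕ) :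
    Measurable ((Sum.elim W X : ℕ ⊕ ℕ → Ω → ℝ) i) := by
  cases i
  · exact h.meas_W _
  · exact h.meas_X _

theorem IsRenewalModel.shift (h : IsRenewalModel P m μ W X) :
    IsRenewalModel P m μ (fun i => W (i + 1)) (fun i => X (i + 1)) where
  meas_W i := h.meas_W _
  meas_X i := h.meas_X _
  map_W i := h.map_W _
  map_X i := h.map_X _
  indep := by
    have := h.indep.precomp (g := Sum.map (· + 1) (· + 1))
      (Function.Injective.sumMap (add_left_injective 1) (add_left_injective 1))
    convert this using 1
    ext i
    cases i <;> rfl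

/-- The two vectors are built from disjoint sets of indices of one independent family, so they
generate independent σ-algebras. -/
theorem IsRenewalModel.indepFun_first (h : IsRenewalModel P m μ W X) :
    IndepFun (fun ω => (W 0 ω, X 0 ω))
      (fun ω => ((fun i => W (i + 1) ω : ℕ → ℝ), (fun i => X (i + 1) ω : ℕ → ℝ))) P := by
  set Z : ℕ ⊕ ℕ → Ω → ℝ := Sum.elim W X with hZ
  set S : Set (ℕ ⊕ ℕ) := {Sum.inl 0, Sum.inr 0}
  have hI := indep_iSup_of_disjoint (fun i => (h.meas i).comap_le) h.indep.iIndep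
    (disjoint_compl_right (a := S))
  rw [IndepFun_iff_Indep]
  have hle : ∀ (T : Set (ℕ ⊕ ℕ)) (i : ℕ ⊕ ℕ), i ∈ T →
      Measurable[⨆ i ∈ T, MeasurableSpace.comap (Z i) inferInstance] (Z i) := fun T i hi =>
    measurable_iff_comap_le.2 (le_iSup₂_of_le i hi le_rfl)
  refine indep_of_indep_of_le_left (indep_of_indep_of_le_right hI ?_) ?_
  · refine measurable_iff_comap_le.1 (Measurable.prodMk ?_ ?_)
    · exact @measurable_pi_lambda _ _ _ (_) _ _ fun i => hle Sᶜ (Sum.inl (i + 1)) (by simp [S])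
    · exact @measurable_pi_lambda _ _ _ (_) _ _ fun i => hle Sᶜ (Sum.inr (i + 1)) (by simp [S])
  · refine measurable_iff_comap_le.1 (Measurable.prodMk ?_ ?_)
    · exact hle S (Sum.inl 0) (by simp [S])
    · exact hle S (Sum.inr 0) (by simp [S])

variable [IsProbabilityMeasure P]

theorem IsRenewalModel.map_first (h : IsRenewalModel P m μ W X) :
    P.map (fun ω => (W 0 ω, X 0 ω)) = m.prod μ := by
  have hI : IndepFun (W 0) (X 0) P := h.indep.indepFun (i := Sum.inl 0) (j := Sum.inr 0) (by simp)
  rw [hI.map_prod_eq_prod_map_map (h.meas_W 0).aemeasurable (h.meas_X 0).aemeasurable, h.map_W,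
    h.map_X]

theorem IsRenewalModel.isProbabilityMeasure (h : IsRenewalModel P m μ W X) :
    IsProbabilityMeasure m ∧ IsProbabilityMeasure μ :=
  ⟨h.map_W 0 ▸ Measure.isProbabilityMeasure_map (h.meas_W 0).aemeasurable,
    h.map_X 0 ▸ Measure.isProbabilityMeasure_map (h.meas_X 0).aemeasurable⟩

/-- Chernoff bound at exponent `-1`: the `n`-th claim comes by time `k` with probability at most
`exp k * q ^ n`, where `q = E exp (-W)`. Almost sure positivity of `W` gives `q < 1`. -/
theorem IsRenewalModel.nonExplosive (h : IsRenewalModel P m μ W X) (hm : m (Iic 0) = 0) :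
    ∀ᵐ ω ∂P, NonExplosive fun i => W i ω := by
  have hpos : ∀ i, ∀ᵐ ω ∂P, 0 < W i ω := by
    intro i
    rw [← h.map_W i, Measure.map_apply (h.meas_W i) measurableSet_Iic] at hm
    rw [ae_iff]
    simpa [preimage, not_lt] using hm
  have hint : ∀ (Y : Ω → ℝ), Measurable Y → (∀ᵐ ω ∂P, 0 ≤ Y ω) →
      Integrable (fun ω => Real.exp (-1 * Y ω)) P := by
    intro Y hY hY0
    refine Integrable.of_bound (by fun_prop) 1 (hY0.mono fun ω hω => ?_)
    rw [Real.norm_eq_abs, Real.abs_exp]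
    exact Real.exp_le_one_iff.2 (by linarith)
  have hq : ∀ i, mgf (W i) P (-1) = mgf id m (-1) := by
    intro i
    rw [← h.map_W i, mgf_id_map (h.meas_W i).aemeasurable]
  have hq0 : 0 ≤ mgf id m (-1) := mgf_nonneg
  have hq1 : mgf id m (-1) < 1 := by
    rw [← hq 0, mgf, ← sub_pos]
    have hi := hint (W 0) (h.meas_W 0) ((hpos 0).mono fun _ h => h.le)
    have e : 1 - ∫ ω, Real.exp (-1 * W 0 ω) ∂P = ∫ ω, (1 - Real.exp (-1 * W 0 ω)) ∂P := by
      rw [integral_sub (integrable_const _) hi]; simp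
    rw [e, integral_pos_iff_support_of_nonneg_ae]
    · have : ∀ᵐ ω ∂P, ω ∈ Function.support fun ω => 1 - Real.exp (-1 * W 0 ω) := by
        filter_upwards [hpos 0] with ω hω
        rw [Function.mem_support, sub_ne_zero]
        exact (Real.exp_lt_one_iff.2 (by linarith)).ne'
      exact (measure_congr (Filter.eventuallyEq_univ.2 this)).symm ▸ by simp
    · filter_upwards [hpos 0] with ω hω
      exact sub_nonneg.2 (Real.exp_le_one_iff.2 (by linarith))
    · exact (integrable_const _).sub hi
  have hIW : iIndepFun W P := h.indep.precomp (g := Sum.inl) Sum.inl_injective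
  have hunb : ∀ k : ℕ, ∀ᵐ ω ∂P, ∃ n, (k : ℝ) < arrivalTime (fun i => W i ω) n := by
    intro k
    have hbd : ∀ n, P.real {ω | ¬ ∃ n, (k : ℝ) < arrivalTime (fun i => W i ω) n} ≤
        Real.exp k * mgf id m (-1) ^ n := by
      intro n
      have h1 := measure_le_le_exp_mul_mgf (μ := P) (X := ∑ i ∈ Finset.range n, W i) (k : ℝ)
        (t := -1) (by norm_num) (hint _ (by
          simpa only [Finset.sum_fn] using Finset.measurable_sum (Finset.range n) fun i _ => h.meas_W i) (by
          filter_upwards [ae_all_iff.2 hpos] with ω hω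
          rw [Finset.sum_apply]
          exact Finset.sum_nonneg fun i _ => (hω i).le))
      rw [hIW.mgf_sum h.meas_W] at h1
      simp only [hq, Finset.prod_const, Finset.card_range, neg_neg, one_mul] at h1
      refine (measureReal_mono ?_).trans h1
      intro ω hω
      simp only [not_exists, not_lt, mem_ofPred_eq, arrivalTime, Finset.sum_apply] at hω ⊢
      exact hω n
    have hlim : Filter.Tendsto (fun n : ℕ => Real.exp k * mgf id m (-1) ^ n) Filter.atTop
        (nhds (Real.exp k * 0)) := (tendsto_pow_atTop_nhds_zero_of_lt_one hq0 hq1).const_mul _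
    rw [mul_zero] at hlim
    have := ge_of_tendsto' hlim hbd
    rw [ae_iff]
    exact (measureReal_eq_zero_iff).1 (le_antisymm this measureReal_nonneg)
  filter_upwards [ae_all_iff.2 hpos, ae_all_iff.2 hunb] with ω h1 h2
  refine ⟨h1, fun t => ?_⟩
  obtain ⟨k, hk⟩ := exists_nat_gt t
  exact (h2 k).imp fun n hn => hk.trans hn

end

theorem measurable_driftFlow (b c₁ c₂ : ℝ) :
    Measurable fun p : ℝ × ℝ => driftFlow b c₁ c₂ p.1 p.2 := by
  unfold driftFlow
  refine Measurable.ite (measurableSet_le (by fun_prop) (by fun_prop)) (Measurable.ite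
    (measurableSet_le (by fun_prop) (by fun_prop)) ?_ ?_) ?_ <;> fun_prop

theorem measurable_ruinWithin (b c₁ c₂ r δ : ℝ) (n : ℕ) :
    Measurable fun p : ℝ × (ℕ → ℝ) × (ℕ → ℝ) => ruinWithin b c₁ c₂ r δ n p.1 p.2.1 p.2.2 := by
  induction n with
  | zero =>
    exact Measurable.ite (measurableSet_lt measurable_fst measurable_const) measurable_const
      measurable_const
  | succ n ih =>
    refine Measurable.ite (measurableSet_lt measurable_fst measurable_const) measurable_const ?_
    have h1 : Measurable fun p : ℝ × (ℕ → ℝ) × (ℕ → ℝ) =>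
        (driftFlow b c₁ c₂ p.1 (p.2.1 0) - p.2.2 0, (fun i => p.2.1 (i + 1) : ℕ → ℝ),
          (fun i => p.2.2 (i + 1) : ℕ → ℝ)) := by
      have h2 : Measurable fun p : ℝ × (ℕ → ℝ) × (ℕ → ℝ) => driftFlow b c₁ c₂ p.1 (p.2.1 0) :=
        (measurable_driftFlow b c₁ c₂).comp (g := fun q : ℝ × ℝ => driftFlow b c₁ c₂ q.1 q.2)
          (f := fun p : ℝ × (ℕ → ℝ) × (ℕ → ℝ) => (p.1, p.2.1 0)) (by fun_prop)
      fun_prop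
    have h3 := ih.comp h1
    simp only [Function.comp_def] at h3
    fun_prop

section

variable {Ω : Type*} [MeasurableSpace Ω] {P : Measure Ω} {m μ : Measure ℝ} {W X : ℕ → Ω → ℝ}
  {b c₁ c₂ r δ : ℝ}

theorem IsRenewalModel.measurable_ruinWithin (h : IsRenewalModel P m μ W X) (n : ℕ) :
    Measurable fun p : ℝ × Ω =>
      ruinWithin b c₁ c₂ r δ n p.1 (fun i => W i p.2) (fun i => X i p.2) := by
  have hW := h.meas_W
  have hX := h.meas_X
  exact (RiskModel.measurable_ruinWithin b c₁ c₂ r δ n).comp (g := fun p : ℝ × (ℕ → ℝ) × (ℕ → ℝ) =>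
    ruinWithin b c₁ c₂ r δ n p.1 p.2.1 p.2.2)
    (f := fun p : ℝ × Ω => (p.1, (fun i => W i p.2 : ℕ → ℝ), (fun i => X i p.2 : ℕ → ℝ)))
    (by fun_prop)

/-- The expected discount `E[r^{N_τ} e^{-δτ}; τ < ∞]` of the refracted process. -/
noncomputable def ruinTransform (P : Measure Ω) (W X : ℕ → Ω → ℝ) (b c₁ c₂ r δ u : ℝ) : ℝ :=
  ∫ ω, ruinDiscount r δ (fun i => W i ω)
    (refractedSurplus b c₁ c₂ u (fun i => W i ω) (fun i => X i ω)) ∂P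

theorem ruinTransform_nonneg (hr : 0 ≤ r) (u : ℝ) : 0 ≤ ruinTransform P W X b c₁ c₂ r δ u :=
  integral_nonneg fun _ => ruinDiscount_nonneg hr _ _

variable [IsProbabilityMeasure P]

theorem IsRenewalModel.ruinWithin_ae (h : IsRenewalModel P m μ W X) (hm : m (Iic 0) = 0)
    (hr : 0 ≤ r) (hr1 : r ≤ 1) (hδ : 0 ≤ δ) (n : ℕ) (u : ℝ) :
    ∀ᵐ ω ∂P, ‖ruinWithin b c₁ c₂ r δ n u (fun i => W i ω) (fun i => X i ω)‖ ≤ 1 := by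
  filter_upwards [h.nonExplosive hm] with ω hω
  obtain ⟨h0, h1⟩ := ruinWithin_nonneg_le_one (b := b) (c₁ := c₁) (c₂ := c₂) hr hr1 hδ n u
    (fun i => W i ω) (fun i => X i ω) fun i => (hω.1 i).le
  rwa [Real.norm_eq_abs, abs_of_nonneg h0]

/-- The first pair is independent of the shifted sequences, so the joint law is a product and Fubini
applies. -/
theorem IsRenewalModel.integral_ruinWithin_succ (h : IsRenewalModel P m μ W X)
    (hm : m (Iic 0) = 0) (hr : 0 ≤ r) (hr1 : r ≤ 1) (hδ : 0 ≤ δ) (n : ℕ) {u : ℝ} (hu : 0 ≤ u) :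
    ∫ ω, ruinWithin b c₁ c₂ r δ (n + 1) u (fun i => W i ω) (fun i => X i ω) ∂P =
      ∫ p, r * Real.exp (-δ * p.1) * ∫ ω, ruinWithin b c₁ c₂ r δ n
        (driftFlow b c₁ c₂ u p.1 - p.2) (fun i => W (i + 1) ω) (fun i => X (i + 1) ω) ∂P
        ∂(m.prod μ) := by
  have := h.isProbabilityMeasure.1
  have := h.isProbabilityMeasure.2
  have hW := h.meas_W
  have hX := h.meas_X
  set T : Ω → (ℕ → ℝ) × (ℕ → ℝ) := fun ω => (fun i => W (i + 1) ω, fun i => X (i + 1) ω) with hT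
  have hTm : Measurable T := by fun_prop
  set F : (ℝ × ℝ) × ((ℕ → ℝ) × (ℕ → ℝ)) → ℝ := fun q => r * Real.exp (-δ * q.1.1) *
    ruinWithin b c₁ c₂ r δ n (driftFlow b c₁ c₂ u q.1.1 - q.1.2) q.2.1 q.2.2 with hF
  have hFm : Measurable F := by
    have h2 : Measurable fun q : (ℝ × ℝ) × ((ℕ → ℝ) × (ℕ → ℝ)) => driftFlow b c₁ c₂ u q.1.1 :=
      (RiskModel.measurable_driftFlow b c₁ c₂).comp
        (g := fun q : ℝ × ℝ => driftFlow b c₁ c₂ q.1 q.2)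
        (f := fun q : (ℝ × ℝ) × ((ℕ → ℝ) × (ℕ → ℝ)) => (u, q.1.1)) (by fun_prop)
    have h3 := (RiskModel.measurable_ruinWithin b c₁ c₂ r δ n).comp
      (g := fun p : ℝ × (ℕ → ℝ) × (ℕ → ℝ) => ruinWithin b c₁ c₂ r δ n p.1 p.2.1 p.2.2)
      (f := fun q : (ℝ × ℝ) × ((ℕ → ℝ) × (ℕ → ℝ)) =>
        (driftFlow b c₁ c₂ u q.1.1 - q.1.2, q.2.1, q.2.2)) (by fun_prop)
    simp only [Function.comp_def] at h3
    fun_prop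
  have hfst : Measurable fun ω => (W 0 ω, X 0 ω) := by fun_prop
  have hlaw : P.map (fun ω => ((W 0 ω, X 0 ω), T ω)) = (m.prod μ).prod (P.map T) := by
    rw [h.indepFun_first.map_prod_eq_prod_map_map hfst.aemeasurable hTm.aemeasurable, h.map_first]
  have e1 : ∀ ω, ruinWithin b c₁ c₂ r δ (n + 1) u (fun i => W i ω) (fun i => X i ω) =
      F ((W 0 ω, X 0 ω), T ω) := by
    intro ω
    rw [ruinWithin, if_neg (not_lt.2 hu)]
  have : IsProbabilityMeasure (P.map T) := Measure.isProbabilityMeasure_map hTm.aemeasurable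
  have hFi : Integrable F ((m.prod μ).prod (P.map T)) := by
    rw [← hlaw]
    refine Integrable.of_bound hFm.aestronglyMeasurable 1 ?_
    rw [ae_map_iff (hfst.prodMk hTm).aemeasurable (measurableSet_le (by fun_prop) (by fun_prop))]
    filter_upwards [h.ruinWithin_ae (b := b) (c₁ := c₁) (c₂ := c₂) hm hr hr1 hδ (n + 1) u]
      with ω hω
    rwa [← e1]
  simp_rw [e1]
  rw [← integral_map (hfst.prodMk hTm).aemeasurable hFm.aestronglyMeasurable (f := F), hlaw,
    integral_prod F hFi]
  refine integral_congr_ae (Filter.Eventually.of_forall fun p => ?_)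
  simp only [hF]
  rw [integral_const_mul, integral_map hTm.aemeasurable]
  exact ((RiskModel.measurable_ruinWithin b c₁ c₂ r δ n).comp
    (g := fun p : ℝ × (ℕ → ℝ) × (ℕ → ℝ) => ruinWithin b c₁ c₂ r δ n p.1 p.2.1 p.2.2)
    (f := fun q : (ℕ → ℝ) × (ℕ → ℝ) => (driftFlow b c₁ c₂ u p.1 - p.2, q.1, q.2))
    (by fun_prop)).aestronglyMeasurable

/-- The expected discount of ruin within the first `n` claims depends only on the laws. -/
theorem IsRenewalModel.integral_ruinWithin_shift (hm : m (Iic 0) = 0) (hr : 0 ≤ r) (hr1 : r ≤ 1)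
    (hδ : 0 ≤ δ) (n : ℕ) (u : ℝ) (h : IsRenewalModel P m μ W X) :
    ∫ ω, ruinWithin b c₁ c₂ r δ n u (fun i => W (i + 1) ω) (fun i => X (i + 1) ω) ∂P =
      ∫ ω, ruinWithin b c₁ c₂ r δ n u (fun i => W i ω) (fun i => X i ω) ∂P := by
  induction n generalizing u W X with
  | zero => rfl
  | succ n ih =>
    rcases lt_or_ge u 0 with hu | hu
    · simp only [ruinWithin, if_pos hu]
    · rw [h.integral_ruinWithin_succ hm hr hr1 hδ n hu,
        h.shift.integral_ruinWithin_succ hm hr hr1 hδ n hu]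
      refine integral_congr_ae (Filter.Eventually.of_forall fun p => ?_)
      simp only
      rw [ih _ h.shift]

/-- An infimum over uncountably many times is not obviously measurable; as an almost sure limit of
the measurable `ruinWithin` it causes no difficulty. -/
theorem IsRenewalModel.aestronglyMeasurable_ruinDiscount (h : IsRenewalModel P m μ W X)
    (hm : m (Iic 0) = 0) (h₁ : 0 < c₁) (h₂ : 0 < c₂) (hb : 0 ≤ b) (hr : 0 ≤ r) (hr1 : r ≤ 1)
    (hδ : 0 < δ) (u : ℝ) :
    AEStronglyMeasurable (fun ω => ruinDiscount r δ (fun i => W i ω)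
      (refractedSurplus b c₁ c₂ u (fun i => W i ω) (fun i => X i ω))) P := by
  refine aestronglyMeasurable_of_tendsto_ae Filter.atTop
    (f := fun n ω => ruinWithin b c₁ c₂ r δ n u (fun i => W i ω) (fun i => X i ω))
    (fun n => ((h.measurable_ruinWithin n).comp measurable_prodMk_left).aestronglyMeasurable) ?_
  filter_upwards [h.nonExplosive hm] with ω hω
  exact hω.tendsto_ruinWithin h₁ h₂ hb hr hr1 hδ u _

theorem IsRenewalModel.integrable_ruinDiscount (h : IsRenewalModel P m μ W X)
    (hm : m (Iic 0) = 0) (h₁ : 0 < c₁) (h₂ : 0 < c₂) (hb : 0 ≤ b) (hr : 0 ≤ r) (hr1 : r ≤ 1)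
    (hδ : 0 < δ) (u : ℝ) :
    Integrable (fun ω => ruinDiscount r δ (fun i => W i ω)
      (refractedSurplus b c₁ c₂ u (fun i => W i ω) (fun i => X i ω))) P := by
  refine Integrable.of_bound (h.aestronglyMeasurable_ruinDiscount hm h₁ h₂ hb hr hr1 hδ u) 1
    (Filter.Eventually.of_forall fun ω => ?_)
  rw [Real.norm_eq_abs, abs_of_nonneg (ruinDiscount_nonneg hr _ _)]
  exact ruinDiscount_le_one hr hr1 hδ.le _ _

theorem IsRenewalModel.tendsto_integral_ruinWithin (h : IsRenewalModel P m μ W X)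
    (hm : m (Iic 0) = 0) (h₁ : 0 < c₁) (h₂ : 0 < c₂) (hb : 0 ≤ b) (hr : 0 ≤ r) (hr1 : r ≤ 1)
    (hδ : 0 < δ) (u : ℝ) :
    Filter.Tendsto
      (fun n => ∫ ω, ruinWithin b c₁ c₂ r δ n u (fun i => W i ω) (fun i => X i ω) ∂P)
      Filter.atTop (nhds (ruinTransform P W X b c₁ c₂ r δ u)) := by
  refine tendsto_integral_of_dominated_convergence (fun _ => 1)
    (fun n => ((h.measurable_ruinWithin n).comp measurable_prodMk_left).aestronglyMeasurable)
    (integrable_const _) (fun n => h.ruinWithin_ae hm hr hr1 hδ.le n u) ?_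
  filter_upwards [h.nonExplosive hm] with ω hω
  exact hω.tendsto_ruinWithin h₁ h₂ hb hr hr1 hδ u _

theorem IsRenewalModel.measurable_integral_ruinWithin (h : IsRenewalModel P m μ W X) (n : ℕ) :
    Measurable fun u =>
      ∫ ω, ruinWithin b c₁ c₂ r δ n u (fun i => W i ω) (fun i => X i ω) ∂P :=
  ((h.measurable_ruinWithin n).stronglyMeasurable.integral_prod_right (ν := P)).measurable

theorem IsRenewalModel.measurable_ruinTransform (h : IsRenewalModel P m μ W X)
    (hm : m (Iic 0) = 0) (h₁ : 0 < c₁) (h₂ : 0 < c₂) (hb : 0 ≤ b) (hr : 0 ≤ r) (hr1 : r ≤ 1)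
    (hδ : 0 < δ) : Measurable (ruinTransform P W X b c₁ c₂ r δ) :=
  measurable_of_tendsto_metrizable h.measurable_integral_ruinWithin
    (tendsto_pi_nhds.2 (h.tendsto_integral_ruinWithin hm h₁ h₂ hb hr hr1 hδ))

theorem IsRenewalModel.ruinTransform_le_one (h : IsRenewalModel P m μ W X)
    (hm : m (Iic 0) = 0) (h₁ : 0 < c₁) (h₂ : 0 < c₂) (hb : 0 ≤ b) (hr : 0 ≤ r) (hr1 : r ≤ 1)
    (hδ : 0 < δ) (u : ℝ) : ruinTransform P W X b c₁ c₂ r δ u ≤ 1 := by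
  have := integral_mono (h.integrable_ruinDiscount hm h₁ h₂ hb hr hr1 hδ u) (integrable_const 1)
    fun ω => ruinDiscount_le_one hr hr1 hδ.le _ _
  simpa [ruinTransform] using this

theorem IsRenewalModel.ruinTransform_of_neg (h : IsRenewalModel P m μ W X)
    (hm : m (Iic 0) = 0) (h₁ : 0 < c₁) (hb : 0 ≤ b) {u : ℝ} (hu : u < 0) :
    ruinTransform P W X b c₁ c₂ r δ u = 1 := by
  rw [ruinTransform, integral_congr_ae (g := fun _ => 1)]
  · simp
  · filter_upwards [h.nonExplosive hm] with ω hω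
    exact ruinDiscount_of_neg _ h₁ hb hω hu

/-- Conditioning on the first claim. -/
theorem IsRenewalModel.ruinTransform_eq (h : IsRenewalModel P m μ W X)
    (hm : m (Iic 0) = 0) (h₁ : 0 < c₁) (h₂ : 0 < c₂) (hb : 0 ≤ b) (hr : 0 ≤ r) (hr1 : r ≤ 1)
    (hδ : 0 < δ) {u : ℝ} (hu : 0 ≤ u) :
    ruinTransform P W X b c₁ c₂ r δ u = ∫ t, r * Real.exp (-δ * t) *
      ∫ x, ruinTransform P W X b c₁ c₂ r δ (driftFlow b c₁ c₂ u t - x) ∂μ ∂m := by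
  have := h.isProbabilityMeasure.1
  have := h.isProbabilityMeasure.2
  have hpos : ∀ᵐ p ∂(m.prod μ), 0 ≤ p.1 := by
    have : ∀ᵐ t ∂m, 0 ≤ t := by
      rw [ae_iff]
      exact measure_mono_null (fun t ht => (not_le.1 ht).le) hm
    exact Measure.quasiMeasurePreserving_fst.ae this
  have hflow : Measurable fun p : ℝ × ℝ => driftFlow b c₁ c₂ u p.1 - p.2 := by
    have := (RiskModel.measurable_driftFlow b c₁ c₂).comp
        (g := fun q : ℝ × ℝ => driftFlow b c₁ c₂ q.1 q.2)
        (f := fun q : ℝ × ℝ => (u, q.1)) (by fun_prop)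
    simp only [Function.comp_def] at this
    fun_prop
  have hexp : ∀ t : ℝ, 0 ≤ t → |r * Real.exp (-δ * t)| ≤ 1 := by
    intro t ht
    rw [abs_of_nonneg (by positivity)]
    exact mul_le_one₀ hr1 (Real.exp_nonneg _)
      (Real.exp_le_one_iff.2 (by nlinarith))
  have hmeas : ∀ φ : ℝ → ℝ, Measurable φ → Measurable fun p : ℝ × ℝ =>
      r * Real.exp (-δ * p.1) * φ (driftFlow b c₁ c₂ u p.1 - p.2) := by
    intro φ hφ
    have := hφ.comp hflow
    simp only [Function.comp_def] at this
    fun_prop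
  have hΦ := h.measurable_ruinTransform hm h₁ h₂ hb hr hr1 hδ
  have hbound : ∀ φ : ℝ → ℝ, (∀ y, |φ y| ≤ 1) → ∀ᵐ p : ℝ × ℝ ∂(m.prod μ),
      ‖r * Real.exp (-δ * p.1) * φ (driftFlow b c₁ c₂ u p.1 - p.2)‖ ≤ 1 := by
    intro φ hφ
    filter_upwards [hpos] with p hp
    rw [Real.norm_eq_abs, abs_mul]
    exact mul_le_one₀ (hexp _ hp) (abs_nonneg _) (hφ _)
  -- The finite-claim recursion passes to the limit by dominated convergence. The inner integral
  -- over the shifted sequences was identified with the unshifted one because only the laws matter.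
  have hlim : Filter.Tendsto
      (fun n => ∫ ω, ruinWithin b c₁ c₂ r δ (n + 1) u (fun i => W i ω) (fun i => X i ω) ∂P)
      Filter.atTop (nhds (∫ p, r * Real.exp (-δ * p.1) *
        ruinTransform P W X b c₁ c₂ r δ (driftFlow b c₁ c₂ u p.1 - p.2) ∂(m.prod μ))) := by
    simp_rw [h.integral_ruinWithin_succ hm hr hr1 hδ.le _ hu,
      IsRenewalModel.integral_ruinWithin_shift hm hr hr1 hδ.le _ _ h]
    refine tendsto_integral_of_dominated_convergence (fun _ => 1)
      (fun n => (hmeas _ (h.measurable_integral_ruinWithin n)).aestronglyMeasurable)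
      (integrable_const _) (fun n => hbound (fun y => ∫ ω, ruinWithin b c₁ c₂ r δ n y (fun i => W i ω)
        (fun i => X i ω) ∂P) fun y => ?_)
      (Filter.Eventually.of_forall fun p =>
        (h.tendsto_integral_ruinWithin hm h₁ h₂ hb hr hr1 hδ _).const_mul _)
    have := norm_integral_le_of_norm_le_const
      (h.ruinWithin_ae (b := b) (c₁ := c₁) (c₂ := c₂) hm hr hr1 hδ.le n y)
    simpa using this
  rw [tendsto_nhds_unique ((Filter.tendsto_add_atTop_iff_nat 1).2
    (h.tendsto_integral_ruinWithin hm h₁ h₂ hb hr hr1 hδ u)) hlim, integral_prod]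
  · simp_rw [integral_const_mul]
  · refine Integrable.of_bound (hmeas _ hΦ).aestronglyMeasurable 1 (hbound _ fun y => ?_)
    rw [abs_of_nonneg (ruinTransform_nonneg hr y)]
    exact h.ruinTransform_le_one hm h₁ h₂ hb hr hr1 hδ y

end

/-! ### Convolutions and the translation operator -/

/-- Fubini on the square for `F` extended by zero off the triangle `s ≤ z`. -/
theorem integral_triangle_swap {F : ℝ → ℝ → ℝ} {u v : ℝ} (huv : u ≤ v)
    (hF : IntegrableOn F.uncurry (uIoc u v ×ˢ uIoc u v)) :
    ∫ z in u..v, ∫ s in u..z, F z s = ∫ s in u..v, ∫ z in s..v, F z s := by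
  set H : ℝ → ℝ → ℝ := fun z s => if s ≤ z then F z s else 0 with hH
  have hHi : IntegrableOn H.uncurry (uIoc u v ×ˢ uIoc u v) := by
    have : H.uncurry = indicator {p : ℝ × ℝ | p.2 ≤ p.1} F.uncurry := by
      ext ⟨z, s⟩
      simp [hH, indicator, Function.uncurry]
    rw [this]
    exact hF.indicator (measurableSet_le measurable_snd measurable_fst)
  have hsw := intervalIntegral_intervalIntegral_swap hHi
  rw [intervalIntegral.integral_congr_Ioo_of_le (g := fun z => ∫ s in u..v, H z s) huv,
    hsw, intervalIntegral.integral_congr_Ioo_of_le huv]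
  · intro s hs
    simp only [hH]
    rw [intervalIntegral.integral_of_le huv, intervalIntegral.integral_of_le hs.2.le]
    have : (fun z => if s ≤ z then F z s else 0) = indicator (Ici s) fun z => F z s := by
      ext z; simp [indicator]
    have hset : Ioc u v ∩ Ici s = Icc s v := by
      ext z
      simp only [mem_inter_iff, mem_Ioc, mem_Ici, mem_Icc]
      exact ⟨fun h => ⟨h.2, h.1.2⟩, fun h => ⟨⟨hs.1.trans_le h.1, h.2⟩, h.1⟩⟩
    rw [this, setIntegral_indicator measurableSet_Ici, hset, integral_Icc_eq_integral_Ioc]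
  · intro z hz
    simp only [hH]
    rw [← intervalIntegral.integral_indicator (f := F z) (Ioo_subset_Icc_self hz)]
    congr 1

theorem conv_comm (g h : ℝ → ℝ) (t : ℝ) : conv g h t = conv h g t := by
  have := intervalIntegral.integral_comp_sub_left (a := 0) (b := t) (fun x => g (t - x) * h x) t
  simp only [sub_sub_cancel, sub_zero, sub_self] at this
  rw [conv, this, conv]
  exact intervalIntegral.integral_congr fun x _ => mul_comm _ _

theorem continuous_conv {g h : ℝ → ℝ} (hg : Continuous g) (hh : Continuous h) :
    Continuous (conv g h) :=
  intervalIntegral.continuous_parametric_intervalIntegral_of_continuous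
    (f := fun t x => g x * h (t - x)) (by fun_prop) continuous_id

theorem conv_assoc {k g h : ℝ → ℝ} (hk : Continuous k) (hg : Continuous g) (hh : Continuous h)
    {t : ℝ} (ht : 0 ≤ t) : conv (conv k g) h t = conv k (conv g h) t := by
  have hcont : Continuous (Function.uncurry fun s x : ℝ => k x * g (s - x) * h (t - s)) := by
    fun_prop
  have hint : IntegrableOn (Function.uncurry fun s x : ℝ => k x * g (s - x) * h (t - s))
      (uIoc 0 t ×ˢ uIoc 0 t) :=
    (hcont.continuousOn.integrableOn_compact (isCompact_Icc.prod isCompact_Icc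
      (s := Icc 0 t) (t := Icc 0 t))).mono_set
      (by rw [uIoc_of_le ht]; exact prod_mono Ioc_subset_Icc_self Ioc_subset_Icc_self)
  have hsw := integral_triangle_swap ht hint
  simp only [conv]
  simp_rw [← intervalIntegral.integral_mul_const, ← intervalIntegral.integral_const_mul]
  rw [hsw]
  refine intervalIntegral.integral_congr fun x _ => ?_
  have := intervalIntegral.integral_comp_sub_right (a := x) (b := t)
    (fun y => k x * (g y * h (t - x - y))) x
  simp only [sub_self] at this
  rw [← this]
  refine intervalIntegral.integral_congr fun s _ => ?_
  simp only [mul_assoc]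
  congr 3
  ring

/-- The integral of a convolution. -/
theorem integral_conv {g h : ℝ → ℝ} {u : ℝ} (hu : 0 ≤ u) (hg : IntervalIntegrable g volume 0 u)
    (hh : Integrable h) :
    ∫ z in (0 : ℝ)..u, conv g h z = conv g (fun t => ∫ y in (0 : ℝ)..t, h y) u := by
  have hint : IntegrableOn (Function.uncurry fun z x : ℝ => g x * h (z - x))
      (uIoc 0 u ×ˢ uIoc 0 u) := by
    have h1 : Integrable (indicator (uIoc 0 u) g) :=
      (integrable_indicator_iff measurableSet_uIoc).2 ((intervalIntegrable_iff).1 hg)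
    have h2 := (h1.convolution_integrand (ContinuousLinearMap.mul ℝ ℝ) hh).integrableOn
      (s := uIoc 0 u ×ˢ uIoc 0 u)
    refine h2.congr_fun (fun p hp => ?_) (measurableSet_uIoc.prod measurableSet_uIoc)
    simp [indicator_of_mem hp.2, Function.uncurry]
  simp only [conv]
  rw [integral_triangle_swap hu hint]
  refine intervalIntegral.integral_congr fun x _ => ?_
  simp only [intervalIntegral.integral_const_mul]
  rw [intervalIntegral.integral_comp_sub_right (fun y => h y), sub_self]

theorem translationOp_eq (ρ : ℝ) (g : ℝ → ℝ) (x : ℝ) :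
    translationOp ρ g x = Real.exp (ρ * x) * ∫ y in Ioi x, Real.exp (-ρ * y) * g y := by
  rw [translationOp, ← integral_const_mul]
  congr 1
  ext y
  rw [← mul_assoc, ← Real.exp_add]
  congr 2
  ring

theorem exp_mul_translationOp (ρ : ℝ) (g : ℝ → ℝ) (x : ℝ) :
    Real.exp (-ρ * x) * translationOp ρ g x = ∫ y in Ioi x, Real.exp (-ρ * y) * g y := by
  rw [translationOp_eq, ← mul_assoc, ← Real.exp_add]
  simp

/-- After discounting, `T_ρ g` is a tail integral, so its increments are plain integrals. Continuity
and every later cancellation of `T_ρ` terms rest on this. -/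
theorem exp_mul_translationOp_sub {ρ : ℝ} {g : ℝ → ℝ}
    (hg : ∀ x, IntegrableOn (fun y => Real.exp (-ρ * y) * g y) (Ioi x)) (u v : ℝ) :
    Real.exp (-ρ * u) * translationOp ρ g u - Real.exp (-ρ * v) * translationOp ρ g v =
      ∫ y in u..v, Real.exp (-ρ * y) * g y := by
  rw [exp_mul_translationOp, exp_mul_translationOp, intervalIntegral.integral_Ioi_sub_Ioi' (hg u) (hg v)]

theorem continuous_translationOp {ρ : ℝ} {g : ℝ → ℝ}
    (hg : ∀ x, IntegrableOn (fun y => Real.exp (-ρ * y) * g y) (Ioi x)) :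
    Continuous (translationOp ρ g) := by
  have hi : ∀ a b, IntervalIntegrable (fun y => Real.exp (-ρ * y) * g y) volume a b := by
    intro a b
    rw [intervalIntegrable_iff]
    exact (hg (min a b)).mono_set fun x hx => hx.1
  have h1 := intervalIntegral.continuous_primitive hi 0
  have h2 : translationOp ρ g = fun x => Real.exp (ρ * x) *
      (translationOp ρ g 0 - ∫ y in (0 : ℝ)..x, Real.exp (-ρ * y) * g y) := by
    ext x
    rw [← exp_mul_translationOp_sub hg 0 x, mul_zero, Real.exp_zero, one_mul, sub_sub_cancel,
      ← mul_assoc, ← Real.exp_add]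
    simp
  rw [h2]
  fun_prop

theorem integral_const_mul_exp (q u v : ℝ) :
    ∫ x in u..v, q * Real.exp (q * x) = Real.exp (q * v) - Real.exp (q * u) := by
  refine intervalIntegral.integral_eq_sub_of_hasDerivAt (f := fun x => Real.exp (q * x))
    (fun x _ => ?_) ((by fun_prop : Continuous fun x => q * Real.exp (q * x)).intervalIntegrable _ _)
  have := ((hasDerivAt_id x).const_mul q).exp
  simpa [mul_comm] using this

/-! ### Claim densities and their translation operators -/

/-- The density of a non-negative random variable. -/
structure IsClaimDensity (f : ℝ → ℝ) : Prop where
  measurable : Measurable f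
  nonneg : ∀ x, 0 ≤ f x
  supp : ∀ x, x < 0 → f x = 0
  integrable : Integrable f
  integral_eq_one : ∫ x, f x = 1

namespace IsClaimDensity

variable {f : ℝ → ℝ} (hf : IsClaimDensity f) {ρ : ℝ}

include hf

theorem tail_eq (x : ℝ) : tail f x = ∫ y in Ioi x, f y := by
  rw [tail, ← hf.integral_eq_one, ← intervalIntegral.integral_Iic_add_Ioi (b := x)
    hf.integrable.integrableOn hf.integrable.integrableOn]
  ring

theorem tail_nonneg (x : ℝ) : 0 ≤ tail f x := by
  rw [hf.tail_eq]
  exact setIntegral_nonneg measurableSet_Ioi fun y _ => hf.nonneg y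

theorem tail_le_one (x : ℝ) : tail f x ≤ 1 := by
  have : 0 ≤ ∫ y in Iic x, f y := setIntegral_nonneg measurableSet_Iic fun y _ => hf.nonneg y
  rw [tail]
  linarith

theorem measurable_tail : Measurable (tail f) := by
  refine Antitone.measurable fun x y hxy => ?_
  have : ∫ z in Iic x, f z ≤ ∫ z in Iic y, f z := setIntegral_mono_set
    hf.integrable.integrableOn (Filter.Eventually.of_forall hf.nonneg)
    (Iic_subset_Iic.2 hxy).eventuallyLE
  simp only [tail]
  linarith

theorem integrable_exp_mul (hρ : 0 ≤ ρ) : Integrable fun y => Real.exp (-ρ * y) * f y := by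
  have := hf.measurable
  refine hf.integrable.mono' (by fun_prop) (Filter.Eventually.of_forall fun y => ?_)
  rw [Real.norm_eq_abs, abs_of_nonneg (mul_nonneg (Real.exp_nonneg _) (hf.nonneg y))]
  rcases lt_or_ge y 0 with hy | hy
  · simp [hf.supp y hy]
  · exact mul_le_of_le_one_left (hf.nonneg y) (Real.exp_le_one_iff.2 (by nlinarith))

theorem integrableOn_exp_mul_tail (hρ : 0 < ρ) (x : ℝ) :
    IntegrableOn (fun y => Real.exp (-ρ * y) * tail f y) (Ioi x) := by
  have := hf.measurable_tail
  refine (integrableOn_exp_mul_Ioi (neg_lt_zero.2 hρ) x).mono' (by fun_prop)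
    (Filter.Eventually.of_forall fun y => ?_)
  rw [Real.norm_eq_abs, abs_of_nonneg (mul_nonneg (Real.exp_nonneg _) (hf.tail_nonneg y))]
  exact mul_le_of_le_one_right (Real.exp_nonneg _) (hf.tail_le_one y)

theorem continuous_translationOp (hρ : 0 ≤ ρ) : Continuous (translationOp ρ f) :=
  RiskModel.continuous_translationOp fun _ => (hf.integrable_exp_mul hρ).integrableOn

theorem continuous_translationOp_tail (hρ : 0 < ρ) : Continuous (translationOp ρ (tail f)) :=
  RiskModel.continuous_translationOp (hf.integrableOn_exp_mul_tail hρ)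

theorem translationOp_nonneg (ρ x : ℝ) : 0 ≤ translationOp ρ f x :=
  setIntegral_nonneg measurableSet_Ioi fun y _ => mul_nonneg (Real.exp_nonneg _) (hf.nonneg y)

theorem translationOp_le_tail (hρ : 0 ≤ ρ) (x : ℝ) : translationOp ρ f x ≤ tail f x := by
  rw [hf.tail_eq]
  refine setIntegral_mono_on ?_ hf.integrable.integrableOn measurableSet_Ioi fun y hy => ?_
  · have := ((hf.integrable_exp_mul hρ).const_mul (Real.exp (ρ * x))).integrableOn (s := Ioi x)
    refine this.congr_fun (fun y _ => ?_) measurableSet_Ioi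
    simp only
    rw [← mul_assoc, ← Real.exp_add]
    congr 2
    ring
  · refine mul_le_of_le_one_left (hf.nonneg y) (Real.exp_le_one_iff.2 ?_)
    have : 0 < y - x := sub_pos.2 hy
    nlinarith

theorem translationOp_le_one (hρ : 0 ≤ ρ) (x : ℝ) : translationOp ρ f x ≤ 1 :=
  (hf.translationOp_le_tail hρ x).trans (hf.tail_le_one x)

theorem translationOp_tail_nonneg (ρ x : ℝ) : 0 ≤ translationOp ρ (tail f) x :=
  setIntegral_nonneg measurableSet_Ioi fun y _ =>
    mul_nonneg (Real.exp_nonneg _) (hf.tail_nonneg y)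

theorem translationOp_tail_le (hρ : 0 < ρ) (x : ℝ) : translationOp ρ (tail f) x ≤ 1 / ρ := by
  rw [translationOp_eq]
  have h1 : ∫ y in Ioi x, Real.exp (-ρ * y) * tail f y ≤ ∫ y in Ioi x, Real.exp (-ρ * y) :=
    setIntegral_mono_on (hf.integrableOn_exp_mul_tail hρ x)
      (integrableOn_exp_mul_Ioi (neg_lt_zero.2 hρ) x) measurableSet_Ioi fun y _ =>
      mul_le_of_le_one_right (Real.exp_nonneg _) (hf.tail_le_one y)
  rw [integral_exp_mul_Ioi (neg_lt_zero.2 hρ)] at h1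
  calc _ ≤ Real.exp (ρ * x) * (-Real.exp (-ρ * x) / -ρ) := by gcongr
    _ = 1 / ρ := by
      rw [neg_div_neg_eq, ← mul_div_assoc, ← Real.exp_add]; simp

/-- The truncated Laplace transform of the density. -/
theorem integral_exp_mul (hρ : 0 ≤ ρ) (t : ℝ) :
    ∫ y in (0 : ℝ)..t, Real.exp (-ρ * y) * f y =
      laplace f ρ - Real.exp (-ρ * t) * translationOp ρ f t := by
  rw [← exp_mul_translationOp_sub fun _ => (hf.integrable_exp_mul hρ).integrableOn]
  simp [translationOp, laplace]

theorem integral_Ioi_eq_one : ∫ x in Ioi (0 : ℝ), f x = 1 := by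
  rw [← integral_Ici_eq_integral_Ioi, ← hf.integral_eq_one]
  refine setIntegral_eq_integral_of_forall_compl_eq_zero fun x hx => hf.supp x ?_
  simpa using hx

/-- `ρ ∫_0^t T_ρ f ≤ 1 - f̂(ρ)`. -/
theorem integral_translationOp_le (hρ : 0 ≤ ρ) {t : ℝ} (ht : 0 ≤ t) :
    ρ * ∫ x in (0 : ℝ)..t, translationOp ρ f x ≤ 1 - laplace f ρ := by
  have hK : Continuous (translationOp ρ f) := hf.continuous_translationOp hρ
  have hi : IntervalIntegrable (fun x => Real.exp (ρ * x)) volume 0 t :=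
    (by fun_prop : Continuous fun x => Real.exp (ρ * x)).intervalIntegrable _ _
  have hsw : ∫ x in (0 : ℝ)..t, ρ * Real.exp (ρ * x) * ∫ y in x..t, Real.exp (-ρ * y) * f y =
      ∫ y in (0 : ℝ)..t, (1 - Real.exp (-ρ * y)) * f y := by
    have hint : IntegrableOn (Function.uncurry fun y x : ℝ =>
        (Real.exp (-ρ * y) * f y) * (ρ * Real.exp (ρ * x))) (uIoc 0 t ×ˢ uIoc 0 t) := by
      rw [IntegrableOn, Measure.volume_eq_prod, ← Measure.prod_restrict]
      exact (hf.integrable_exp_mul hρ).integrableOn.mul_prod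
        ((intervalIntegrable_iff).1 (hi.const_mul ρ))
    have := integral_triangle_swap ht hint
    simp only [intervalIntegral.integral_mul_const] at this
    simp_rw [mul_comm (ρ * Real.exp _)]
    rw [← this]
    refine intervalIntegral.integral_congr fun y _ => ?_
    simp only [intervalIntegral.integral_const_mul (Real.exp (-ρ * y) * f y), integral_const_mul_exp]
    rw [mul_zero, Real.exp_zero]
    have : Real.exp (-ρ * y) * Real.exp (ρ * y) = 1 := by rw [← Real.exp_add]; simp
    linear_combination f y * this
  have hsub : ∀ x, ρ * translationOp ρ f x =
      ρ * Real.exp (ρ * x) * (Real.exp (-ρ * t) * translationOp ρ f t) +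
        ρ * Real.exp (ρ * x) * ∫ y in x..t, Real.exp (-ρ * y) * f y := by
    intro x
    have h1 : Real.exp (ρ * x) * Real.exp (-ρ * x) = 1 := by rw [← Real.exp_add]; simp
    rw [← exp_mul_translationOp_sub fun _ => (hf.integrable_exp_mul hρ).integrableOn]
    linear_combination -ρ * translationOp ρ f x * h1
  have hc : Continuous fun x => ρ * Real.exp (ρ * x) * ∫ y in x..t, Real.exp (-ρ * y) * f y := by
    have : ∀ x, ∫ y in x..t, Real.exp (-ρ * y) * f y =
        Real.exp (-ρ * x) * translationOp ρ f x - Real.exp (-ρ * t) * translationOp ρ f t :=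
      fun x => (exp_mul_translationOp_sub
        (fun _ => (hf.integrable_exp_mul hρ).integrableOn) x t).symm
    simp_rw [this]
    fun_prop
  have hsplit : ∫ y in (0 : ℝ)..t, (1 - Real.exp (-ρ * y)) * f y =
      (∫ y in (0 : ℝ)..t, f y) - ∫ y in (0 : ℝ)..t, Real.exp (-ρ * y) * f y := by
    rw [← intervalIntegral.integral_sub hf.integrable.intervalIntegrable
      (hf.integrable_exp_mul hρ).intervalIntegrable]
    simp only [sub_mul, one_mul]
  have htail : tail f t = 1 - ∫ y in (0 : ℝ)..t, f y := by
    rw [hf.tail_eq, ← hf.integral_Ioi_eq_one, ← intervalIntegral.integral_Ioi_sub_Ioi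
      hf.integrable.integrableOn ht]
    ring
  have h1 : Real.exp (ρ * t) * Real.exp (-ρ * t) = 1 := by rw [← Real.exp_add]; simp
  rw [← intervalIntegral.integral_const_mul]
  simp_rw [hsub]
  rw [intervalIntegral.integral_add ((hi.const_mul ρ).mul_const _) (hc.intervalIntegrable _ _), hsw,
    intervalIntegral.integral_mul_const, integral_const_mul_exp, hsplit, hf.integral_exp_mul hρ]
  -- The rest is the exact identity `ρ ∫₀ᵗ T_ρ f = ∫₀ᵗ f - f̂(ρ) + T_ρ f (t)`; the only inequality
  -- is `T_ρ f (t) ≤ tail f t`.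
  have h2 := hf.translationOp_le_tail hρ t
  rw [htail] at h2
  rw [mul_zero, Real.exp_zero]
  linear_combination h2 + translationOp ρ f t * h1

end IsClaimDensity

/-! ### Volterra equations of convolution type -/

theorem continuous_convPow {k : ℝ → ℝ} (hk : Continuous k) (n : ℕ) : Continuous (convPow k n) := by
  induction n with
  | zero => exact hk
  | succ n ih => exact continuous_conv hk ih

theorem continuous_convPowConv {k h : ℝ → ℝ} (hk : Continuous k) (hh : Continuous h) (n : ℕ) :
    Continuous (convPowConv k h n) := by
  cases n with
  | zero => exact hh
  | succ n => exact continuous_conv (continuous_convPow hk n) hh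

/-- The definition convolves the powers of `k` before applying them to `h`. Associativity turns this
into repeated application of `k *`, the form suited to induction. -/
theorem convPowConv_succ {k h : ℝ → ℝ} (hk : Continuous k) (hh : Continuous h) (n : ℕ) {t : ℝ}
    (ht : 0 ≤ t) : convPowConv k h (n + 1) t = conv k (convPowConv k h n) t := by
  cases n with
  | zero => rfl
  | succ n => exact conv_assoc hk (continuous_convPow hk n) hh ht

/-- Each convolution with a kernel bounded by `1` integrates the bound once and so gains a
factorial. Hence the series converge, and the Volterra solutions are unique, for every coefficient
`a`. -/
theorem abs_conv_le {k g : ℝ → ℝ} {B M : ℝ} {n : ℕ} (hk : ∀ x, 0 ≤ x → |k x| ≤ 1)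
    (hg : ∀ x, 0 ≤ x → x ≤ B → |g x| ≤ M * (x ^ n / n.factorial)) {t : ℝ} (ht : 0 ≤ t)
    (htB : t ≤ B) : |conv k g t| ≤ M * (t ^ (n + 1) / (n + 1).factorial) := by
  have e : ∫ x in (0 : ℝ)..t, M * (x ^ n / n.factorial) =
      M * (t ^ (n + 1) / (n + 1).factorial) := by
    rw [intervalIntegral.integral_const_mul, intervalIntegral.integral_div, integral_pow,
      Nat.factorial_succ]
    push_cast
    field_simp
    simp
  rw [conv_comm, conv, ← e, ← Real.norm_eq_abs]
  refine intervalIntegral.norm_integral_le_of_norm_le ht (Filter.Eventually.of_forall fun x hx => ?_)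
    ((by fun_prop : Continuous fun x : ℝ => M * (x ^ n / n.factorial)).intervalIntegrable _ _)
  rw [Real.norm_eq_abs, abs_mul]
  have h1 := hg x hx.1.le (hx.2.trans htB)
  exact (mul_le_of_le_one_right (abs_nonneg _) (hk _ (by linarith [hx.2]))).trans h1

theorem abs_convPowConv_le {k h : ℝ → ℝ} (hk : Continuous k) (hh : Continuous h) {B M : ℝ}
    (hk1 : ∀ x, 0 ≤ x → |k x| ≤ 1) (hM : ∀ x, 0 ≤ x → x ≤ B → |h x| ≤ M) (n : ℕ) {t : ℝ}
    (ht : 0 ≤ t) (htB : t ≤ B) : |convPowConv k h n t| ≤ M * (t ^ n / n.factorial) := by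
  induction n generalizing t with
  | zero => simpa [convPowConv] using hM t ht htB
  | succ n ih =>
    rw [convPowConv_succ hk hh n ht]
    exact abs_conv_le hk1 (fun x h0 h1 => ih h0 h1) ht htB

theorem exists_abs_le_of_continuous {h : ℝ → ℝ} (hh : Continuous h) (B : ℝ) :
    ∃ M, ∀ x, 0 ≤ x → x ≤ B → |h x| ≤ M := by
  obtain ⟨M, hM⟩ := (isCompact_Icc (a := (0 : ℝ)) (b := B)).exists_bound_of_continuousOn
    hh.continuousOn
  exact ⟨M, fun x h0 h1 => hM x ⟨h0, h1⟩⟩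

/-- The resolvent series `∑ aⁿ k^{n*} * h`. -/
noncomputable def resolvent (a : ℝ) (k h : ℝ → ℝ) (u : ℝ) : ℝ := ∑' n, a ^ n * convPowConv k h n u

section

variable {k h : ℝ → ℝ} (hk : Continuous k) (hh : Continuous h) (hk1 : ∀ x, 0 ≤ x → |k x| ≤ 1)

include hk hh hk1

/-- Exponential-series majorant, uniform on `[0, B]`. It yields summability, continuity of the sum
and termwise integration. -/
theorem exists_bound_resolvent_term (a B : ℝ) : ∃ b : ℕ → ℝ, Summable b ∧
    ∀ n t, 0 ≤ t → t ≤ B → |a ^ n * convPowConv k h n t| ≤ b n := by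
  obtain ⟨M, hM⟩ := exists_abs_le_of_continuous hh B
  refine ⟨fun n => M * ((|a| * B) ^ n / n.factorial),
    (Real.summable_pow_div_factorial (|a| * B)).mul_left M, fun n t h0 h1 => ?_⟩
  have hM0 : 0 ≤ M := (abs_nonneg _).trans (hM t h0 h1)
  have h2 := abs_convPowConv_le hk hh hk1 hM n h0 h1
  rw [abs_mul, abs_pow]
  calc |a| ^ n * |convPowConv k h n t| ≤ |a| ^ n * (M * (t ^ n / n.factorial)) := by gcongr
    _ ≤ |a| ^ n * (M * (B ^ n / n.factorial)) := by gcongr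
    _ = _ := by simp only [mul_pow]; ring

theorem summable_resolvent (a : ℝ) {u : ℝ} (hu : 0 ≤ u) :
    Summable fun n => a ^ n * convPowConv k h n u := by
  obtain ⟨b, hb, hle⟩ := exists_bound_resolvent_term hk hh hk1 a u
  exact Summable.of_norm_bounded hb fun n => hle n u hu le_rfl

theorem continuousOn_resolvent (a B : ℝ) : ContinuousOn (resolvent a k h) (Icc 0 B) := by
  obtain ⟨b, hb, hle⟩ := exists_bound_resolvent_term hk hh hk1 a B
  exact continuousOn_tsum (fun n => (continuous_const.mul
    (continuous_convPowConv hk hh n)).continuousOn) hb fun n x hx => hle n x hx.1 hx.2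

/-- The resolvent series solves the Volterra equation. -/
theorem resolvent_eq (a : ℝ) {u : ℝ} (hu : 0 ≤ u) :
    resolvent a k h u = h u + a * conv k (resolvent a k h) u := by
  obtain ⟨b, hb, hle⟩ := exists_bound_resolvent_term hk hh hk1 a u
  have hsum : HasSum (fun n => ∫ x in (0 : ℝ)..u, k x * (a ^ n * convPowConv k h n (u - x)))
      (conv k (resolvent a k h) u) := by
    refine intervalIntegral.hasSum_integral_of_dominated_convergence (fun n _ => b n)
      (fun n => ?_) (fun n => Filter.Eventually.of_forall fun x hx => ?_)
      (Filter.Eventually.of_forall fun _ _ => hb) (by simp)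
      (Filter.Eventually.of_forall fun x hx => ?_)
    · have := continuous_convPowConv hk hh n
      exact (by fun_prop : Continuous fun x =>
        k x * (a ^ n * convPowConv k h n (u - x))).aestronglyMeasurable
    · rw [uIoc_of_le hu] at hx
      rw [Real.norm_eq_abs, abs_mul]
      exact (mul_le_of_le_one_left (abs_nonneg _) (hk1 x hx.1.le)).trans
        (hle n (u - x) (by linarith [hx.2]) (by linarith [hx.1]))
    · rw [uIoc_of_le hu] at hx
      exact ((summable_resolvent hk hh hk1 a (u := u - x) (by linarith [hx.2])).hasSum).mul_left _
  have hterm : ∀ n, a * ∫ x in (0 : ℝ)..u, k x * (a ^ n * convPowConv k h n (u - x)) =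
      a ^ (n + 1) * convPowConv k h (n + 1) u := by
    intro n
    rw [convPowConv_succ hk hh n hu, conv, ← intervalIntegral.integral_const_mul,
      ← intervalIntegral.integral_const_mul]
    refine intervalIntegral.integral_congr fun x _ => ?_
    ring
  rw [resolvent, (summable_resolvent hk hh hk1 a hu).tsum_eq_zero_add,
    ← (hsum.mul_left a).tsum_eq, tsum_congr hterm]
  simp [convPowConv]

end

/-- A bounded solution of the homogeneous Volterra equation vanishes. -/
theorem eq_zero_of_eq_conv {k d : ℝ → ℝ} (hk1 : ∀ x, 0 ≤ x → |k x| ≤ 1) {a B M : ℝ}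
    (hM : ∀ x, 0 ≤ x → x ≤ B → |d x| ≤ M)
    (hd : ∀ x, 0 ≤ x → x ≤ B → d x = a * conv k d x) {u : ℝ} (hu : 0 ≤ u) (huB : u ≤ B) :
    d u = 0 := by
  -- Iterating the equation `n` times leaves `M (|a| x)^n / n!`, which tends to `0`.
  have key : ∀ n : ℕ, ∀ x, 0 ≤ x → x ≤ B → |d x| ≤ M * |a| ^ n * (x ^ n / n.factorial) := by
    intro n
    induction n with
    | zero => simpa using hM
    | succ n ih =>
      intro x h0 h1
      have := abs_conv_le hk1 ih h0 h1
      rw [hd x h0 h1, abs_mul]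
      calc _ ≤ |a| * (M * |a| ^ n * (x ^ (n + 1) / (n + 1).factorial)) := by gcongr
        _ = _ := by ring
  have hlim : Filter.Tendsto (fun n : ℕ => M * ((|a| * u) ^ n / n.factorial)) Filter.atTop
      (nhds (M * 0)) := (FloorSemiring.tendsto_pow_div_factorial_atTop _).const_mul M
  rw [mul_zero] at hlim
  have := ge_of_tendsto' hlim fun n => (key n u hu huB).trans_eq (by rw [mul_pow]; ring)
  exact abs_nonpos_iff.1 this

/-! ### The series for `φ_∞` and `ν` -/

theorem phiInfTerm_eq (c lam r ρ : ℝ) (f : ℝ → ℝ) (u : ℝ) (n : ℕ) :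
    phiInfTerm c lam r ρ f u n = lam * r / c * ((lam * r / c) ^ n *
      convPowConv (translationOp ρ f) (translationOp ρ (tail f)) n u) := by
  rw [phiInfTerm, pow_succ]
  ring

theorem phiInf_eq (c lam r ρ : ℝ) (f : ℝ → ℝ) (u : ℝ) :
    phiInf c lam r ρ f u = lam * r / c *
      resolvent (lam * r / c) (translationOp ρ f) (translationOp ρ (tail f)) u := by
  rw [phiInf, resolvent, ← tsum_mul_left]
  exact tsum_congr (phiInfTerm_eq c lam r ρ f u)

theorem nu_eq (c lam r ρ : ℝ) (f : ℝ → ℝ) :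
    nu c lam r ρ f = resolvent (lam * r / c) (translationOp ρ f) fun x => Real.exp (ρ * x) := rfl

theorem conv_nonneg {g h : ℝ → ℝ} (hg : ∀ x, 0 ≤ x → 0 ≤ g x) (hh : ∀ x, 0 ≤ x → 0 ≤ h x) {t : ℝ}
    (ht : 0 ≤ t) : 0 ≤ conv g h t :=
  intervalIntegral.integral_nonneg ht fun x hx =>
    mul_nonneg (hg x hx.1) (hh (t - x) (by linarith [hx.2]))

theorem convPow_nonneg {k : ℝ → ℝ} (hk : ∀ x, 0 ≤ x → 0 ≤ k x) (n : ℕ) {t : ℝ} (ht : 0 ≤ t) :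
    0 ≤ convPow k n t := by
  induction n generalizing t with
  | zero => exact hk t ht
  | succ n ih => exact conv_nonneg hk (fun x hx => ih hx) ht

theorem convPowConv_nonneg {k h : ℝ → ℝ} (hk : ∀ x, 0 ≤ x → 0 ≤ k x) (hh : ∀ x, 0 ≤ x → 0 ≤ h x)
    (n : ℕ) {t : ℝ} (ht : 0 ≤ t) : 0 ≤ convPowConv k h n t := by
  cases n with
  | zero => exact hh t ht
  | succ n => exact conv_nonneg (fun x hx => convPow_nonneg hk n hx) hh ht

/-- Raising the endpoint raises the factor `h (t - x)` and adds a non-negative piece of the range.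
No monotonicity of `k` is needed. -/
theorem convPowConv_mono {k h : ℝ → ℝ} (hkc : Continuous k) (hhc : Continuous h)
    (hk : ∀ x, 0 ≤ x → 0 ≤ k x) (hh : ∀ x, 0 ≤ x → 0 ≤ h x) (hmono : Monotone h) (n : ℕ) {s t : ℝ}
    (hs : 0 ≤ s) (hst : s ≤ t) : convPowConv k h n s ≤ convPowConv k h n t := by
  cases n with
  | zero => exact hmono hst
  | succ n =>
    have hc := continuous_convPow hkc n
    have hi : ∀ v p q : ℝ, IntervalIntegrable (fun x => convPow k n x * h (v - x)) volume p q :=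
      fun v p q => (by fun_prop : Continuous fun x =>
        convPow k n x * h (v - x)).intervalIntegrable _ _
    simp only [convPowConv, conv]
    rw [← intervalIntegral.integral_add_adjacent_intervals (hi t 0 s) (hi t s t)]
    have h1 : ∫ x in (0 : ℝ)..s, convPow k n x * h (s - x) ≤
        ∫ x in (0 : ℝ)..s, convPow k n x * h (t - x) :=
      intervalIntegral.integral_mono_on hs (hi s 0 s) (hi t 0 s) fun x hx =>
        mul_le_mul_of_nonneg_left (hmono (by linarith)) (convPow_nonneg hk n hx.1)
    have h2 : 0 ≤ ∫ x in s..t, convPow k n x * h (t - x) :=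
      intervalIntegral.integral_nonneg hst fun x hx =>
        mul_nonneg (convPow_nonneg hk n (hs.trans hx.1)) (hh _ (by linarith [hx.2]))
    linarith

section

variable {f : ℝ → ℝ} (hf : IsClaimDensity f) {c lam r ρ : ℝ}

include hf

theorem IsClaimDensity.abs_translationOp_le (hρ : 0 ≤ ρ) (x : ℝ) : |translationOp ρ f x| ≤ 1 := by
  rw [abs_of_nonneg (hf.translationOp_nonneg ρ x)]
  exact hf.translationOp_le_one hρ x

theorem IsClaimDensity.summable_phiInfTerm (hρ : 0 < ρ) {u : ℝ} (hu : 0 ≤ u) :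
    Summable (phiInfTerm c lam r ρ f u) := by
  have := (summable_resolvent (hf.continuous_translationOp hρ.le)
    (hf.continuous_translationOp_tail hρ) (fun x _ => hf.abs_translationOp_le hρ.le x)
    (lam * r / c) hu).mul_left (lam * r / c)
  exact this.congr fun n => (phiInfTerm_eq c lam r ρ f u n).symm

theorem IsClaimDensity.summable_nuTerm (hρ : 0 ≤ ρ) {u : ℝ} (hu : 0 ≤ u) :
    Summable (nuTerm c lam r ρ f u) :=
  summable_resolvent (hf.continuous_translationOp hρ) (by fun_prop)
    (fun x _ => hf.abs_translationOp_le hρ x) (lam * r / c) hu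

theorem IsClaimDensity.phiInf_eq_conv (hρ : 0 < ρ) {u : ℝ} (hu : 0 ≤ u) :
    phiInf c lam r ρ f u = lam * r / c * (conv (phiInf c lam r ρ f) (translationOp ρ f) u +
      translationOp ρ (tail f) u) := by
  have h1 := resolvent_eq (hf.continuous_translationOp hρ.le)
    (hf.continuous_translationOp_tail hρ) (fun x _ => hf.abs_translationOp_le hρ.le x)
    (lam * r / c) hu
  have h2 : conv (phiInf c lam r ρ f) (translationOp ρ f) u = lam * r / c *
      conv (translationOp ρ f)
        (resolvent (lam * r / c) (translationOp ρ f) (translationOp ρ (tail f))) u := by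
    rw [conv_comm, conv, conv, ← intervalIntegral.integral_const_mul]
    refine intervalIntegral.integral_congr fun x _ => ?_
    simp only [phiInf_eq]
    ring
  rw [phiInf_eq, h2, h1]
  ring

theorem IsClaimDensity.nu_eq_conv (hρ : 0 ≤ ρ) {u : ℝ} (hu : 0 ≤ u) :
    nu c lam r ρ f u = Real.exp (ρ * u) +
      lam * r / c * conv (nu c lam r ρ f) (translationOp ρ f) u := by
  rw [conv_comm, nu_eq]
  exact resolvent_eq (hf.continuous_translationOp hρ) (by fun_prop)
    (fun x _ => hf.abs_translationOp_le hρ x) (lam * r / c) hu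

theorem IsClaimDensity.continuousOn_phiInf (hρ : 0 < ρ) (B : ℝ) :
    ContinuousOn (phiInf c lam r ρ f) (Icc 0 B) := by
  rw [funext (phiInf_eq c lam r ρ f)]
  exact continuousOn_const.mul (continuousOn_resolvent (hf.continuous_translationOp hρ.le)
    (hf.continuous_translationOp_tail hρ) (fun x _ => hf.abs_translationOp_le hρ.le x) _ B)

theorem IsClaimDensity.continuousOn_nu (hρ : 0 ≤ ρ) (B : ℝ) :
    ContinuousOn (nu c lam r ρ f) (Icc 0 B) := by
  rw [nu_eq]
  exact continuousOn_resolvent (hf.continuous_translationOp hρ) (by fun_prop)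
    (fun x _ => hf.abs_translationOp_le hρ x) _ B

theorem IsClaimDensity.nu_mono (hρ : 0 ≤ ρ) (ha : 0 ≤ lam * r / c) {s t : ℝ} (hs : 0 ≤ s)
    (hst : s ≤ t) : nu c lam r ρ f s ≤ nu c lam r ρ f t :=
  (hf.summable_nuTerm hρ hs).tsum_le_tsum (fun n => mul_le_mul_of_nonneg_left
    (convPowConv_mono (hf.continuous_translationOp hρ) (by fun_prop)
      (fun x _ => hf.translationOp_nonneg ρ x) (fun x _ => Real.exp_nonneg _)
      (fun x y hxy => Real.exp_le_exp.2 (mul_le_mul_of_nonneg_left hxy hρ)) n hs hst)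
    (pow_nonneg ha n)) (hf.summable_nuTerm hρ (hs.trans hst))

theorem IsClaimDensity.nu_pos (hρ : 0 ≤ ρ) (ha : 0 ≤ lam * r / c) {u : ℝ} (hu : 0 ≤ u) :
    0 < nu c lam r ρ f u := by
  refine (hf.summable_nuTerm hρ hu).tsum_pos (fun n => mul_nonneg (pow_nonneg ha n)
    (convPowConv_nonneg (fun x _ => hf.translationOp_nonneg ρ x) (fun x _ => Real.exp_nonneg _) n
      hu)) 0 ?_
  simpa [nuTerm, convPowConv] using Real.exp_pos _

/-- Positivity of the denominator of the refracted ruin transform. -/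
theorem IsClaimDensity.denominator_pos {c₁ c₂ δ ρ₁ ρ₂ b : ℝ} (h₁ : 0 < c₁) (h₂ : 0 < c₂)
    (hlam : 0 < lam) (hr : 0 ≤ r) (hr1 : r ≤ 1) (hδ : 0 < δ) (hb : 0 ≤ b) (hρ₁ : 0 ≤ ρ₁)
    (hρ₂ : IsPositiveLundbergRoot c₂ lam δ r f ρ₂) :
    0 < nu c₁ lam r ρ₁ f b -
      lam * r / c₂ * conv (nu c₁ lam r ρ₁ f) (translationOp ρ₂ f) b := by
  obtain ⟨hρ, hroot⟩ := hρ₂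
  have ha : 0 ≤ lam * r / c₁ := by positivity
  set V := nu c₁ lam r ρ₁ f with hV
  set K := translationOp ρ₂ f with hK
  have hKc : Continuous K := hf.continuous_translationOp hρ.le
  have hVc : ContinuousOn V (Icc 0 b) := hf.continuousOn_nu hρ₁ b
  have hpos : 0 < V b := hf.nu_pos hρ₁ ha hb
  -- `V` is nondecreasing, so it is at most `V b` under the convolution integral.
  have h1 : conv V K b ≤ V b * ∫ x in (0 : ℝ)..b, K x := by
    have e := intervalIntegral.integral_comp_sub_left (a := 0) (b := b) K b
    rw [sub_self, sub_zero] at e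
    rw [← e, ← intervalIntegral.integral_const_mul]
    refine intervalIntegral.integral_mono_on hb (ContinuousOn.intervalIntegrable ?_)
      ((by fun_prop : Continuous fun x => V b * K (b - x)).intervalIntegrable _ _) fun x hx =>
      mul_le_mul_of_nonneg_right (hf.nu_mono hρ₁ ha hx.1 hx.2) (hf.translationOp_nonneg _ _)
    rw [uIcc_of_le hb]
    exact hVc.mul (by fun_prop : Continuous fun x => K (b - x)).continuousOn
  have h2 := hf.integral_translationOp_le hρ.le hb
  set I := ∫ x in (0 : ℝ)..b, K x with hI
  -- The Lundberg equation gives `λr (1 - f̂(ρ₂)) = c₂ ρ₂ - (λ + δ) + λr`, which is less than `c₂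
  -- ρ₂` because `r ≤ 1` and `δ > 0`.
  have h3 : lam * r / c₂ * I < 1 := by
    rw [div_mul_eq_mul_div, div_lt_one h₂, ← mul_lt_mul_iff_of_pos_right hρ]
    have : lam * r * (ρ₂ * I) ≤ lam * r * (1 - laplace f ρ₂) :=
      mul_le_mul_of_nonneg_left h2 (by positivity)
    nlinarith
  have h4 : lam * r / c₂ * conv V K b ≤ lam * r / c₂ * (V b * I) :=
    mul_le_mul_of_nonneg_left h1 (by positivity)
  nlinarith [mul_lt_mul_of_pos_left h3 hpos]

end

/-! ### From the first-claim equation to the defective renewal equations -/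

theorem intervalIntegrable_of_abs_le {g : ℝ → ℝ} {M : ℝ} (hg : Measurable g)
    (hM : ∀ x, |g x| ≤ M) (u v : ℝ) : IntervalIntegrable g volume u v :=
  (intervalIntegrable_const (c := M)).mono_fun hg.aestronglyMeasurable
    (Filter.Eventually.of_forall fun x => (hM x).trans (le_abs_self M))

theorem intervalIntegrable_exp_mul {g : ℝ → ℝ} {M : ℝ} (hg : Measurable g)
    (hM : ∀ x, |g x| ≤ M) (κ u v : ℝ) :
    IntervalIntegrable (fun z => Real.exp (κ * z) * g z) volume u v :=
  (intervalIntegrable_of_abs_le hg hM u v).continuousOn_mul (by fun_prop)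

section

variable {f : ℝ → ℝ} (hf : IsClaimDensity f) {Φ G : ℝ → ℝ} {a κ ρ : ℝ}

/-- Formally the hypothesis says `Φ' = κ Φ - a G`, and the conclusion integrates the derivative of
`exp (-ρ s) * Φ s`. Since `G` is only measurable, differentiation is replaced by integrating the
hypothesis against `q * exp (q z)` with `q = κ - ρ` and swapping the integrals. -/
theorem exp_mul_eq_of_exp_mul_eq (hG : Measurable G) (hG1 : ∀ x, |G x| ≤ 1) {u v : ℝ} (huv : u ≤ v)
    (hI : ∀ z, u ≤ z → z ≤ v → Real.exp (-κ * z) * Φ z = Real.exp (-κ * v) * Φ v +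
      a * ∫ s in z..v, Real.exp (-κ * s) * G s) :
    Real.exp (-ρ * u) * Φ u = Real.exp (-ρ * v) * Φ v + a * (∫ s in u..v, Real.exp (-ρ * s) * G s) -
      (κ - ρ) * ∫ s in u..v, Real.exp (-ρ * s) * Φ s := by
  set q := κ - ρ with hq
  set k : ℝ → ℝ := fun s => Real.exp (-κ * s) * G s with hk
  have hki : ∀ p p', IntervalIntegrable k volume p p' := intervalIntegrable_exp_mul hG hG1 (-κ)
  have hexp : ∀ z, Real.exp (q * z) * Real.exp (-κ * z) = Real.exp (-ρ * z) := by
    intro z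
    rw [← Real.exp_add, hq]
    congr 1
    ring
  have hqc : Continuous fun z => q * Real.exp (q * z) := by fun_prop
  have hprim : Continuous fun z => q * Real.exp (q * z) * ∫ s in z..v, k s := by
    have := intervalIntegral.continuous_primitive hki v
    simp_rw [intervalIntegral.integral_symm v]
    fun_prop
  have h1 : q * ∫ s in u..v, Real.exp (-ρ * s) * Φ s =
      Real.exp (-κ * v) * Φ v * (Real.exp (q * v) - Real.exp (q * u)) +
        a * ∫ z in u..v, q * Real.exp (q * z) * ∫ s in z..v, k s := by
    rw [← integral_const_mul_exp, ← intervalIntegral.integral_const_mul,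
      ← intervalIntegral.integral_const_mul, ← intervalIntegral.integral_const_mul,
      ← intervalIntegral.integral_add ((hqc.intervalIntegrable _ _).const_mul _)
        ((hprim.intervalIntegrable _ _).const_mul _)]
    refine intervalIntegral.integral_congr fun z hz => ?_
    rw [uIcc_of_le huv] at hz
    rw [← hexp]
    linear_combination q * Real.exp (q * z) * hI z hz.1 hz.2
  have hint : IntegrableOn (Function.uncurry fun z s : ℝ => k z * (q * Real.exp (q * s)))
      (uIoc u v ×ˢ uIoc u v) := by
    rw [IntegrableOn, Measure.volume_eq_prod, ← Measure.prod_restrict]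
    exact ((intervalIntegrable_iff).1 (hki u v)).mul_prod
      ((intervalIntegrable_iff).1 (hqc.intervalIntegrable u v))
  have h2 := integral_triangle_swap huv hint
  simp only [intervalIntegral.integral_mul_const] at h2
  simp_rw [intervalIntegral.integral_const_mul (k _), integral_const_mul_exp] at h2
  have h3 : ∫ z in u..v, k z * (Real.exp (q * z) - Real.exp (q * u)) =
      (∫ s in u..v, Real.exp (-ρ * s) * G s) - Real.exp (q * u) * ∫ s in u..v, k s := by
    rw [← intervalIntegral.integral_const_mul, ← intervalIntegral.integral_sub
      (intervalIntegrable_exp_mul hG hG1 (-ρ) u v) ((hki u v).const_mul _)]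
    refine intervalIntegral.integral_congr fun z _ => ?_
    simp only [hk]
    rw [← hexp]
    ring
  rw [h1]
  simp_rw [mul_comm (q * Real.exp _)]
  rw [← h2, h3]
  have h4 := hI u le_rfl huv
  rw [← hexp u, ← hexp v]
  linear_combination Real.exp (q * u) * h4

include hf

/-- On a finite range the product rule for Laplace transforms leaves a boundary term; this is where
`T_ρ f` enters the problem. -/
theorem IsClaimDensity.integral_exp_mul_conv (hΦ : Measurable Φ) (hΦ1 : ∀ x, |Φ x| ≤ 1)
    (hρ : 0 ≤ ρ) {t : ℝ} (ht : 0 ≤ t) :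
    ∫ z in (0 : ℝ)..t, Real.exp (-ρ * z) * conv Φ f z =
      laplace f ρ * (∫ x in (0 : ℝ)..t, Real.exp (-ρ * x) * Φ x) -
        Real.exp (-ρ * t) * conv Φ (translationOp ρ f) t := by
  have hK := hf.continuous_translationOp hρ
  have h1 := integral_conv ht (intervalIntegrable_exp_mul hΦ hΦ1 (-ρ) 0 t)
    (hf.integrable_exp_mul hρ)
  have h2 : ∀ z, conv (fun x => Real.exp (-ρ * x) * Φ x) (fun y => Real.exp (-ρ * y) * f y) z =
      Real.exp (-ρ * z) * conv Φ f z := by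
    intro z
    rw [conv, conv, ← intervalIntegral.integral_const_mul]
    refine intervalIntegral.integral_congr fun x _ => ?_
    have : Real.exp (-ρ * x) * Real.exp (-ρ * (z - x)) = Real.exp (-ρ * z) := by
      rw [← Real.exp_add]; congr 1; ring
    rw [← this]
    ring
  simp_rw [h2, hf.integral_exp_mul hρ] at h1
  rw [h1, conv, conv, ← intervalIntegral.integral_const_mul, ← intervalIntegral.integral_const_mul,
    ← intervalIntegral.integral_sub]
  · refine intervalIntegral.integral_congr fun x _ => ?_
    have : Real.exp (-ρ * x) * Real.exp (-ρ * (t - x)) = Real.exp (-ρ * t) := by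
      rw [← Real.exp_add]; congr 1; ring
    rw [← this]
    ring
  · exact (intervalIntegrable_exp_mul hΦ hΦ1 (-ρ) 0 t).const_mul _
  · exact ((intervalIntegrable_of_abs_le hΦ hΦ1 0 t).mul_continuousOn
      (by fun_prop : Continuous fun x => translationOp ρ f (t - x)).continuousOn).const_mul _

/-- The Dickson–Hipp transformation: the defect of the renewal equation, discounted at the Lundberg
root, is constant along a range with constant premium rate. -/
theorem IsClaimDensity.exp_mul_defect_eq (hΦ : Measurable Φ) (hΦ1 : ∀ x, |Φ x| ≤ 1)
    (hG : Measurable G) (hG1 : ∀ x, |G x| ≤ 1)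
    (hGeq : ∀ z, 0 ≤ z → G z = conv Φ f z + tail f z) (hρ : 0 < ρ)
    (hroot : κ - ρ = a * laplace f ρ) {u v : ℝ} (hu : 0 ≤ u) (huv : u ≤ v)
    (hI : ∀ z, u ≤ z → z ≤ v → Real.exp (-κ * z) * Φ z = Real.exp (-κ * v) * Φ v +
      a * ∫ s in z..v, Real.exp (-κ * s) * G s) :
    Real.exp (-ρ * u) * (Φ u - a * (conv Φ (translationOp ρ f) u + translationOp ρ (tail f) u)) =
    Real.exp (-ρ * v) * (Φ v - a * (conv Φ (translationOp ρ f) v + translationOp ρ (tail f) v)) := by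
  have h1 := exp_mul_eq_of_exp_mul_eq (ρ := ρ) hG hG1 huv hI
  have htail1 : ∀ x, |tail f x| ≤ 1 := fun x => by
    rw [abs_of_nonneg (hf.tail_nonneg x)]; exact hf.tail_le_one x
  have hiG := intervalIntegrable_exp_mul hG hG1 (-ρ)
  have hiP := intervalIntegrable_exp_mul hΦ hΦ1 (-ρ)
  have hiT := intervalIntegrable_exp_mul hf.measurable_tail htail1 (-ρ)
  have h2 : ∀ t, 0 ≤ t → ∫ z in (0 : ℝ)..t, Real.exp (-ρ * z) * G z =
      laplace f ρ * (∫ x in (0 : ℝ)..t, Real.exp (-ρ * x) * Φ x) -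
        Real.exp (-ρ * t) * conv Φ (translationOp ρ f) t +
        ∫ z in (0 : ℝ)..t, Real.exp (-ρ * z) * tail f z := by
    intro t ht
    rw [← hf.integral_exp_mul_conv hΦ hΦ1 hρ.le ht, ← sub_eq_iff_eq_add,
      ← intervalIntegral.integral_sub (hiG 0 t) (hiT 0 t)]
    refine intervalIntegral.integral_congr fun z hz => ?_
    rw [uIcc_of_le ht] at hz
    rw [hGeq z hz.1]
    ring
  have h3 := exp_mul_translationOp_sub (hf.integrableOn_exp_mul_tail hρ) u v
  have eG := intervalIntegral.integral_interval_sub_left (hiG 0 v) (hiG 0 u)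
  have eP := intervalIntegral.integral_interval_sub_left (hiP 0 v) (hiP 0 u)
  have eT := intervalIntegral.integral_interval_sub_left (hiT 0 v) (hiT 0 u)
  -- With `κ - ρ = a f̂(ρ)` the integrals of `exp (-ρ s) * Φ s` cancel, and only boundary terms
  -- survive.
  rw [← eG, ← eP, h2 u hu, h2 v (hu.trans huv), hroot] at h1
  rw [← eT] at h3
  linear_combination h1 - a * h3

/-- Above the level from which the premium rate is constant the defect vanishes. -/
theorem IsClaimDensity.defect_eq_zero (hΦ1 : ∀ x, |Φ x| ≤ 1) (hρ : 0 < ρ) {u : ℝ}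
    (hE : ∀ v, u ≤ v → Real.exp (-ρ * u) *
      (Φ u - a * (conv Φ (translationOp ρ f) u + translationOp ρ (tail f) u)) =
      Real.exp (-ρ * v) *
      (Φ v - a * (conv Φ (translationOp ρ f) v + translationOp ρ (tail f) v))) :
    Φ u = a * (conv Φ (translationOp ρ f) u + translationOp ρ (tail f) u) := by
  set D : ℝ → ℝ := fun v => Φ v - a * (conv Φ (translationOp ρ f) v + translationOp ρ (tail f) v)
  -- The defect grows at most linearly in `v`, since the convolution is at most `v` and the other
  -- terms are bounded. The discount at rate `ρ > 0` therefore wins.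
  have hbound : ∀ v, 0 ≤ v → |Real.exp (-ρ * v) * D v| ≤
      (1 + |a| * (1 / ρ)) * Real.exp (-(ρ * v)) +
        |a| * (1 / ρ) * ((ρ * v) ^ 1 * Real.exp (-(ρ * v))) := by
    intro v hv
    have h1 : |conv Φ (translationOp ρ f) v| ≤ v := by
      rw [conv_comm]
      have := abs_conv_le (k := translationOp ρ f) (g := Φ) (B := v) (M := 1) (n := 0)
        (fun x _ => hf.abs_translationOp_le hρ.le x) (fun x _ _ => by simpa using hΦ1 x) hv le_rfl
      simpa using this
    have h2 : |translationOp ρ (tail f) v| ≤ 1 / ρ := by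
      rw [abs_of_nonneg (hf.translationOp_tail_nonneg ρ v)]
      exact hf.translationOp_tail_le hρ v
    have h3 : |D v| ≤ 1 + |a| * (v + 1 / ρ) := by
      refine (abs_sub _ _).trans (add_le_add (hΦ1 v) ?_)
      rw [abs_mul]
      gcongr
      exact (abs_add_le _ _).trans (add_le_add h1 h2)
    rw [abs_mul, Real.abs_exp]
    calc _ ≤ Real.exp (-ρ * v) * (1 + |a| * (v + 1 / ρ)) := by gcongr
      _ = _ := by rw [neg_mul]; field_simp; ring
  have hv : Filter.Tendsto (fun v : ℝ => ρ * v) Filter.atTop Filter.atTop :=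
    Filter.tendsto_id.const_mul_atTop hρ
  have h1 := (Real.tendsto_exp_neg_atTop_nhds_zero.comp hv).const_mul (1 + |a| * (1 / ρ))
  have h2 := ((Real.tendsto_pow_mul_exp_neg_atTop_nhds_zero 1).comp hv).const_mul (|a| * (1 / ρ))
  have h3 := h1.add h2
  rw [mul_zero, mul_zero, add_zero] at h3
  have h4 : |Real.exp (-ρ * u) * D u| ≤ 0 := by
    refine ge_of_tendsto h3 ?_
    filter_upwards [Filter.eventually_ge_atTop u, Filter.eventually_ge_atTop 0] with v hv hv0
    have := hE v hv
    simp only [D] at this ⊢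
    rw [this]
    exact hbound v hv0
  have h5 := abs_nonpos_iff.1 h4
  rcases mul_eq_zero.1 h5 with h | h
  · exact absurd h (Real.exp_ne_zero _)
  · exact sub_eq_zero.1 h

end

/-! ### The ruin transform for exponential inter-arrival times -/

theorem setIntegral_Ioi_eq_comp_add (g : ℝ → ℝ) (s : ℝ) :
    ∫ t in Ioi s, g t = ∫ t in Ioi (0 : ℝ), g (s + t) := by
  rw [← integral_indicator measurableSet_Ioi, ← integral_indicator measurableSet_Ioi,
    ← integral_add_left_eq_self _ s]
  congr 1
  ext t
  simp [indicator]

theorem expMeasure_Iic_zero (lam : ℝ) : expMeasure lam (Iic 0) = 0 := by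
  rw [expMeasure, gammaMeasure, withDensity_apply _ measurableSet_Iic,
    ← setLIntegral_congr (Iio_ae_eq_Iic (a := (0 : ℝ)))]
  exact lintegral_gammaPDF_of_nonpos le_rfl

theorem integral_expMeasure {lam : ℝ} (hlam : 0 < lam) (g : ℝ → ℝ) :
    ∫ t, g t ∂(expMeasure lam) = ∫ t in Ioi (0 : ℝ), lam * Real.exp (-lam * t) * g t := by
  have h1 : ∫ t, g t ∂(expMeasure lam) = ∫ t, exponentialPDFReal lam t * g t := by
    have : gammaPDF 1 lam = fun t => ENNReal.ofReal (gammaPDFReal 1 lam t) := rfl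
    rw [expMeasure, gammaMeasure, this, integral_withDensity_eq_integral_toReal_smul
      (measurable_gammaPDFReal 1 lam).ennreal_ofReal
      (Filter.Eventually.of_forall fun _ => ENNReal.ofReal_lt_top)]
    refine integral_congr_ae (Filter.Eventually.of_forall fun t => ?_)
    simp only [smul_eq_mul]
    rw [ENNReal.toReal_ofReal (gammaPDFReal_nonneg one_pos hlam t)]
    rfl
  have h2 : ∀ t, exponentialPDFReal lam t = if 0 ≤ t then lam * Real.exp (-(lam * t)) else 0 := by
    intro t
    rw [exponentialPDFReal, gammaPDFReal]
    simp only [Real.rpow_one, Real.Gamma_one, div_one, sub_self, Real.rpow_zero, mul_one]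
  rw [h1, ← integral_Ici_eq_integral_Ioi, ← setIntegral_eq_integral_of_forall_compl_eq_zero (s := Ici 0)]
  · refine setIntegral_congr_fun measurableSet_Ici fun t ht => ?_
    rw [h2, if_pos (mem_Ici.1 ht), neg_mul]
  · intro t ht
    rw [h2, if_neg (by simpa using ht), zero_mul]

theorem integral_withDensity_ofReal {f : ℝ → ℝ} (hf : Measurable f) (hf0 : ∀ x, 0 ≤ f x)
    (g : ℝ → ℝ) :
    ∫ x, g x ∂(volume.withDensity fun x => ENNReal.ofReal (f x)) = ∫ x, f x * g x := by
  rw [integral_withDensity_eq_integral_toReal_smul hf.ennreal_ofReal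
    (Filter.Eventually.of_forall fun _ => ENNReal.ofReal_lt_top)]
  refine integral_congr_ae (Filter.Eventually.of_forall fun x => ?_)
  simp only [smul_eq_mul]
  rw [ENNReal.toReal_ofReal (hf0 x)]

theorem isClaimDensity_of_isProbabilityMeasure {f : ℝ → ℝ} (hf : Measurable f) (hf0 : ∀ x, 0 ≤ f x)
    (hsupp : ∀ x, x < 0 → f x = 0)
    (h : IsProbabilityMeasure (volume.withDensity fun x => ENNReal.ofReal (f x))) :
    IsClaimDensity f := by
  have h1 : ∫⁻ x, ENNReal.ofReal (f x) = 1 := by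
    have := h.measure_univ
    rwa [withDensity_apply _ MeasurableSet.univ, Measure.restrict_univ] at this
  have h2 : Integrable f := by
    refine (lintegral_ofReal_ne_top_iff_integrable hf.aestronglyMeasurable
      (Filter.Eventually.of_forall hf0)).1 (by rw [h1]; exact ENNReal.one_ne_top)
  refine ⟨hf, hf0, hsupp, h2, ?_⟩
  rw [integral_eq_lintegral_of_nonneg_ae (Filter.Eventually.of_forall hf0) hf.aestronglyMeasurable,
    h1, ENNReal.toReal_one]

/-- `E[φ(z - X)]` for a claim `X` with density `f`, where `φ = 1` on the negative half-line. -/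
theorem IsClaimDensity.integral_mul_comp_sub {f : ℝ → ℝ} (hf : IsClaimDensity f) {Φ : ℝ → ℝ}
    (hΦ : Measurable Φ) (hΦ1 : ∀ x, |Φ x| ≤ 1) (hneg : ∀ x, x < 0 → Φ x = 1) (z : ℝ) :
    ∫ x, f x * Φ (z - x) = conv Φ f z + tail f z := by
  have hi : Integrable fun x => f x * Φ (z - x) := by
    refine hf.integrable.mul_bdd (c := 1) 
      (hΦ.comp (measurable_const.sub measurable_id)).aestronglyMeasurable
      (Filter.Eventually.of_forall fun x => ?_)
    exact hΦ1 _
  have h1 : ∫ x, f x * Φ (z - x) = ∫ x in Ioi 0, f x * Φ (z - x) := by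
    rw [← integral_Ici_eq_integral_Ioi]
    refine (setIntegral_eq_integral_of_forall_compl_eq_zero fun x hx => ?_).symm
    rw [hf.supp x (by simpa using hx), zero_mul]
  have h2 : ∫ x in Ioi z, f x * Φ (z - x) = tail f z := by
    rw [hf.tail_eq]
    refine setIntegral_congr_fun measurableSet_Ioi fun x hx => ?_
    rw [hneg _ (sub_neg.2 hx), mul_one]
  rw [h1, ← h2, conv_comm, conv]
  exact (intervalIntegral.integral_interval_add_Ioi hi.integrableOn hi.integrableOn).symm

/-- Propagation of the first-claim equation along a stretch with constant premium rate `c`. -/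
theorem exp_mul_eq_of_flow {g : ℝ → ℝ → ℝ} {Φ G : ℝ → ℝ} {β lam r c : ℝ} (hβ : 0 < β) (hc : 0 < c)
    (hG : Measurable G) (hG1 : ∀ x, |G x| ≤ 1) (hg : ∀ y, Measurable (g y))
    (hR : ∀ y, 0 ≤ y → Φ y = ∫ t in Ioi (0 : ℝ), lam * r * (Real.exp (-β * t) * G (g y t)))
    {u v : ℝ} (hu : 0 ≤ u) (huv : u ≤ v) (hlow : ∀ t, 0 ≤ t → u + c * t ≤ v → g u t = u + c * t)
    (hadd : ∀ t, 0 ≤ t → g u ((v - u) / c + t) = g v t) :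
    Real.exp (-(β / c) * u) * Φ u = Real.exp (-(β / c) * v) * Φ v +
      lam * r / c * ∫ s in u..v, Real.exp (-(β / c) * s) * G s := by
  -- `s` is the time the drift needs from `u` to `v`. After `s` the integral restarts from `v` and
  -- contributes `exp (-β s) * Φ v`; before `s` the substitution `z = u + c t` applies.
  set s := (v - u) / c with hs
  have hs0 : 0 ≤ s := div_nonneg (sub_nonneg.2 huv) hc.le
  have hcs : c * s = v - u := by rw [hs]; field_simp
  have hi : IntegrableOn (fun t => lam * r * (Real.exp (-β * t) * G (g u t))) (Ioi 0) := by
    refine Integrable.const_mul ?_ _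
    have := (integrableOn_exp_mul_Ioi (neg_lt_zero.2 hβ) 0)
    have hm := hG.comp (hg u)
    exact this.mul_bdd (c := 1) hm.aestronglyMeasurable
      (Filter.Eventually.of_forall fun t => hG1 _)
  have h1 := intervalIntegral.integral_interval_add_Ioi hi (hi.mono_set (Ioi_subset_Ioi hs0))
  have h2 : ∫ t in Ioi s, lam * r * (Real.exp (-β * t) * G (g u t)) = Real.exp (-β * s) * Φ v := by
    rw [setIntegral_Ioi_eq_comp_add, hR v (hu.trans huv), ← integral_const_mul]
    refine setIntegral_congr_fun measurableSet_Ioi fun t ht => ?_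
    rw [hadd t (le_of_lt ht), mul_add, Real.exp_add]
    ring
  have h3 : ∫ t in (0 : ℝ)..s, lam * r * (Real.exp (-β * t) * G (g u t)) =
      lam * r / c * (Real.exp (β / c * u) * ∫ z in u..v, Real.exp (-(β / c) * z) * G z) := by
    have e := intervalIntegral.integral_comp_add_mul (a := 0) (b := s)
      (fun z => Real.exp (-(β / c) * z) * G z) hc.ne' u
    rw [mul_zero, add_zero, hcs, add_sub_cancel, smul_eq_mul] at e
    have e' : ∫ z in u..v, Real.exp (-(β / c) * z) * G z =
        c * ∫ x in (0 : ℝ)..s, Real.exp (-(β / c) * (u + c * x)) * G (u + c * x) := by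
      rw [e]; field_simp
    rw [e', ← intervalIntegral.integral_const_mul, ← intervalIntegral.integral_const_mul,
      ← intervalIntegral.integral_const_mul]
    refine intervalIntegral.integral_congr fun t ht => ?_
    rw [uIcc_of_le hs0] at ht
    have hexp : Real.exp (-β * t) = Real.exp (β / c * u) * Real.exp (-(β / c) * (u + c * t)) := by
      rw [← Real.exp_add]
      congr 1
      field_simp
      ring
    have hle : u + c * t ≤ v := by
      have := mul_le_mul_of_nonneg_left ht.2 hc.le
      linarith
    rw [hlow t ht.1 hle, hexp]
    field_simp
  rw [← hR u hu, h2, h3] at h1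
  have h4 : Real.exp (-(β / c) * u) * Real.exp (-β * s) = Real.exp (-(β / c) * v) := by
    rw [← Real.exp_add]
    congr 1
    have : v = u + c * s := by linarith
    rw [this]
    field_simp
    ring
  have h5 : Real.exp (-(β / c) * u) * Real.exp (β / c * u) = 1 := by rw [← Real.exp_add]; simp
  rw [← h1, ← h4]
  linear_combination lam * r / c * (∫ z in u..v, Real.exp (-(β / c) * z) * G z) * h5

section

variable {Ω : Type*} [MeasurableSpace Ω] {P : Measure Ω} {W X : ℕ → Ω → ℝ} {f : ℝ → ℝ}
  {lam b c₁ c₂ r δ : ℝ}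

/-- `HasLaw` provides only almost everywhere measurable variables. Measurable versions alter the
paths on a null set, so no expectation changes. -/
theorem exists_isRenewalModel {μ : Measure ℝ} {m : Measure ℝ} (hW : ∀ i, HasLaw (W i) m P)
    (hX : ∀ i, HasLaw (X i) μ P) (h : iIndepFun (Sum.elim W X : ℕ ⊕ ℕ → Ω → ℝ) P) :
    ∃ W' X' : ℕ → Ω → ℝ, IsRenewalModel P m μ W' X' ∧
      ∀ᵐ ω ∂P, (fun i => W i ω) = (fun i => W' i ω) ∧ (fun i => X i ω) = fun i => X' i ω := by
  refine ⟨fun i => (hW i).aemeasurable.mk (W i), fun i => (hX i).aemeasurable.mk (X i),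
    ⟨fun i => (hW i).aemeasurable.measurable_mk, fun i => (hX i).aemeasurable.measurable_mk,
      fun i => ?_, fun i => ?_, h.congr ?_⟩, ?_⟩
  · exact (Measure.map_congr (hW i).aemeasurable.ae_eq_mk.symm).trans (hW i).map_eq
  · exact (Measure.map_congr (hX i).aemeasurable.ae_eq_mk.symm).trans (hX i).map_eq
  · rintro (i | i)
    · exact (hW i).aemeasurable.ae_eq_mk
    · exact (hX i).aemeasurable.ae_eq_mk
  · filter_upwards [ae_all_iff.2 fun i => (hW i).aemeasurable.ae_eq_mk,
      ae_all_iff.2 fun i => (hX i).aemeasurable.ae_eq_mk] with ω h1 h2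
    exact ⟨funext h1, funext h2⟩

/-- With the net profit condition this forces `c₂ > 0`. -/
theorem integral_claim_nonneg (hf : IsClaimDensity f) {Y : Ω → ℝ}
    (hY : HasLaw Y (volume.withDensity fun x => ENNReal.ofReal (f x)) P) : 0 ≤ ∫ ω, Y ω ∂P := by
  have h1 : ∫ ω, Y ω ∂P = ∫ x, x ∂(P.map Y) :=
    (integral_map hY.aemeasurable measurable_id.aestronglyMeasurable).symm
  rw [h1, hY.map_eq, integral_withDensity_ofReal hf.measurable hf.nonneg]
  refine integral_nonneg fun x => ?_
  rcases lt_or_ge x 0 with hx | hx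
  · simp [hf.supp x hx]
  · exact mul_nonneg (hf.nonneg x) hx

theorem IsPositiveLundbergRoot.rate_sub {c ρ : ℝ} (hc : 0 < c)
    (hρ : IsPositiveLundbergRoot c lam δ r f ρ) :
    (lam + δ) / c - ρ = lam * r / c * laplace f ρ := by
  field_simp
  linarith [hρ.2]

/-- Uniqueness for the inhomogeneous Volterra equation solved by `phiInf` and `nu`. -/
theorem IsClaimDensity.eq_phiInf_add_nu (hf : IsClaimDensity f) {ρ B C : ℝ} (hρ : 0 < ρ)
    {Φ : ℝ → ℝ} (hΦ : Measurable Φ) (hΦ1 : ∀ x, |Φ x| ≤ 1)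
    (hV : ∀ u, 0 ≤ u → u ≤ B → Φ u = C * Real.exp (ρ * u) +
      lam * r / c₁ * (conv Φ (translationOp ρ f) u + translationOp ρ (tail f) u))
    {u : ℝ} (hu : 0 ≤ u) (huB : u ≤ B) :
    Φ u = phiInf c₁ lam r ρ f u + C * nu c₁ lam r ρ f u := by
  have hK := hf.continuous_translationOp hρ.le
  have hφ : ContinuousOn (phiInf c₁ lam r ρ f) (Icc 0 B) := hf.continuousOn_phiInf hρ B
  have hν : ContinuousOn (nu c₁ lam r ρ f) (Icc 0 B) := hf.continuousOn_nu hρ.le B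
  obtain ⟨M₁, hM₁⟩ := isCompact_Icc.exists_bound_of_continuousOn hφ
  obtain ⟨M₂, hM₂⟩ := isCompact_Icc.exists_bound_of_continuousOn hν
  -- The inhomogeneous terms cancel in the difference, which is bounded on `[0, B]` and solves the
  -- homogeneous equation.
  have hd := eq_zero_of_eq_conv (k := translationOp ρ f) (a := lam * r / c₁) (B := B)
    (d := fun x => Φ x - phiInf c₁ lam r ρ f x - C * nu c₁ lam r ρ f x) (M := 1 + M₁ + |C| * M₂)
    (fun x _ => hf.abs_translationOp_le hρ.le x) (fun x h0 h1 => ?_) (fun x h0 h1 => ?_) hu huB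
  · linarith
  · refine (abs_sub _ _).trans (add_le_add ((abs_sub _ _).trans (add_le_add (hΦ1 x)
      (hM₁ x ⟨h0, h1⟩))) ?_)
    rw [abs_mul]
    exact mul_le_mul_of_nonneg_left (hM₂ x ⟨h0, h1⟩) (abs_nonneg C)
  · have hKx : ContinuousOn (fun y => translationOp ρ f (x - y)) (uIcc 0 x) := by fun_prop
    have hsub : uIcc 0 x ⊆ Icc 0 B := by
      rw [uIcc_of_le h0]; exact Icc_subset_Icc_right h1
    have i1 : IntervalIntegrable (fun y => Φ y * translationOp ρ f (x - y)) volume 0 x :=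
      (intervalIntegrable_of_abs_le hΦ hΦ1 0 x).mul_continuousOn hKx
    have i2 : IntervalIntegrable (fun y => phiInf c₁ lam r ρ f y * translationOp ρ f (x - y))
      volume 0 x := ((hφ.mono hsub).mul hKx).intervalIntegrable
    have i3 : IntervalIntegrable (fun y => nu c₁ lam r ρ f y * translationOp ρ f (x - y))
      volume 0 x := ((hν.mono hsub).mul hKx).intervalIntegrable
    have e : conv (fun x => Φ x - phiInf c₁ lam r ρ f x - C * nu c₁ lam r ρ f x)
        (translationOp ρ f) x = conv Φ (translationOp ρ f) x -
          conv (phiInf c₁ lam r ρ f) (translationOp ρ f) x -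
          C * conv (nu c₁ lam r ρ f) (translationOp ρ f) x := by
      simp only [conv]
      rw [← intervalIntegral.integral_const_mul, ← intervalIntegral.integral_sub i1 i2,
        ← intervalIntegral.integral_sub (i1.sub i2) (i3.const_mul C)]
      refine intervalIntegral.integral_congr fun y _ => ?_
      ring
    rw [conv_comm, e, hV x h0 h1, hf.phiInf_eq_conv hρ h0, hf.nu_eq_conv hρ.le h0]
    ring

variable [IsProbabilityMeasure P]

/-- The properties of the ruin transform used below: it is bounded by one, and satisfies the
first-claim equation along each stretch with constant premium rate. -/
theorem IsRenewalModel.exists_claim_average (hf : IsClaimDensity f)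
    (h : IsRenewalModel P (expMeasure lam) (volume.withDensity fun x => ENNReal.ofReal (f x)) W X)
    (hlam : 0 < lam) (h₁ : 0 < c₁) (h₂ : 0 < c₂) (hb : 0 ≤ b) (hr : 0 ≤ r) (hr1 : r ≤ 1)
    (hδ : 0 < δ) :
    ∃ G : ℝ → ℝ, Measurable G ∧ (∀ x, |G x| ≤ 1) ∧
      (∀ z, 0 ≤ z → G z = conv (ruinTransform P W X b c₁ c₂ r δ) f z + tail f z) ∧
      (∀ u v, 0 ≤ u → u ≤ v → v ≤ b →
        Real.exp (-((lam + δ) / c₁) * u) * ruinTransform P W X b c₁ c₂ r δ u =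
          Real.exp (-((lam + δ) / c₁) * v) * ruinTransform P W X b c₁ c₂ r δ v +
          lam * r / c₁ * ∫ s in u..v, Real.exp (-((lam + δ) / c₁) * s) * G s) ∧
      (∀ u v, b ≤ u → u ≤ v →
        Real.exp (-((lam + δ) / c₂) * u) * ruinTransform P W X b c₁ c₂ r δ u =
          Real.exp (-((lam + δ) / c₂) * v) * ruinTransform P W X b c₁ c₂ r δ v +
          lam * r / c₂ * ∫ s in u..v, Real.exp (-((lam + δ) / c₂) * s) * G s) := by
  have hm := expMeasure_Iic_zero lam
  set Φ := ruinTransform P W X b c₁ c₂ r δ with hΦdef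
  have hΦ : Measurable Φ := h.measurable_ruinTransform hm h₁ h₂ hb hr hr1 hδ
  have hΦ1 : ∀ x, |Φ x| ≤ 1 := fun x => by
    rw [abs_of_nonneg (ruinTransform_nonneg hr x)]
    exact h.ruinTransform_le_one hm h₁ h₂ hb hr hr1 hδ x
  have hfm := hf.measurable
  set G : ℝ → ℝ := fun z => ∫ x, f x * Φ (z - x) with hGdef
  have hG : Measurable G := by
    have : StronglyMeasurable fun p : ℝ × ℝ => f p.2 * Φ (p.1 - p.2) :=
      (by fun_prop : Measurable fun p : ℝ × ℝ => f p.2 * Φ (p.1 - p.2)).stronglyMeasurable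
    exact (this.integral_prod_right (ν := volume)).measurable
  have hG1 : ∀ x, |G x| ≤ 1 := by
    intro z
    have := norm_integral_le_of_norm_le hf.integrable (f := fun x => f x * Φ (z - x))
      (Filter.Eventually.of_forall fun x => by
        rw [Real.norm_eq_abs, abs_mul, abs_of_nonneg (hf.nonneg x)]
        exact mul_le_of_le_one_right (hf.nonneg x) (hΦ1 _))
    rwa [hf.integral_eq_one] at this
  have hflow : ∀ y, Measurable (driftFlow b c₁ c₂ y) := fun y =>
    (measurable_driftFlow b c₁ c₂).comp (g := fun q : ℝ × ℝ => driftFlow b c₁ c₂ q.1 q.2)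
      (measurable_prodMk_left (x := y))
  -- The exponential density `λ exp (-λ t)` merges with the discount `exp (-δ t)` into rate `λ + δ`.
  have hR : ∀ y, 0 ≤ y → Φ y = ∫ t in Ioi (0 : ℝ),
      lam * r * (Real.exp (-(lam + δ) * t) * G (driftFlow b c₁ c₂ y t)) := by
    intro y hy
    rw [hΦdef, h.ruinTransform_eq hm h₁ h₂ hb hr hr1 hδ hy, integral_expMeasure hlam]
    refine setIntegral_congr_fun measurableSet_Ioi fun t _ => ?_
    rw [integral_withDensity_ofReal hfm hf.nonneg, neg_add, add_mul, Real.exp_add]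
    simp only [hGdef, hΦdef]
    ring
  have hβ : 0 < lam + δ := by linarith
  refine ⟨G, hG, hG1, fun z _ => hf.integral_mul_comp_sub hΦ hΦ1
    (fun x hx => h.ruinTransform_of_neg hm h₁ hb hx) z, fun u v hu huv hv => ?_,
    fun u v hu huv => ?_⟩
  · refine exp_mul_eq_of_flow hβ h₁ hG hG1 hflow hR hu huv (fun t ht hle =>
      driftFlow_of_le h₁ (hle.trans hv) ht) fun t _ => ?_
    have e : u + c₁ * ((v - u) / c₁) = v := by field_simp; ring
    rw [driftFlow_add_of_le h₁ (by rwa [e]) (div_nonneg (sub_nonneg.2 huv) h₁.le), e]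
  · refine exp_mul_eq_of_flow hβ h₂ hG hG1 hflow hR (hb.trans hu) huv (fun t ht _ =>
      driftFlow_of_ge hu ht) fun t ht => ?_
    have e : u + c₂ * ((v - u) / c₂) = v := by field_simp; ring
    rw [driftFlow_add_of_ge h₂ hu (div_nonneg (sub_nonneg.2 huv) h₂.le) ht, e]

/-- From `u ≥ b` the rate `c₂` applies up to infinity, so the defect vanishes. The convolution still
reaches below `b`, which is what couples the two regimes. -/
theorem IsRenewalModel.ruinTransform_eq_of_ge (hf : IsClaimDensity f)
    (h : IsRenewalModel P (expMeasure lam) (volume.withDensity fun x => ENNReal.ofReal (f x)) W X)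
    (hlam : 0 < lam) (h₁ : 0 < c₁) (h₂ : 0 < c₂) (hb : 0 ≤ b) (hr : 0 ≤ r) (hr1 : r ≤ 1)
    (hδ : 0 < δ) {ρ : ℝ} (hρ : IsPositiveLundbergRoot c₂ lam δ r f ρ) {u : ℝ} (hu : b ≤ u) :
    ruinTransform P W X b c₁ c₂ r δ u = lam * r / c₂ *
      (conv (ruinTransform P W X b c₁ c₂ r δ) (translationOp ρ f) u +
        translationOp ρ (tail f) u) := by
  obtain ⟨G, hG, hG1, hGeq, -, hI⟩ := h.exists_claim_average hf hlam h₁ h₂ hb hr hr1 hδ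
  have hm := expMeasure_Iic_zero lam
  have hΦ1 : ∀ x, |ruinTransform P W X b c₁ c₂ r δ x| ≤ 1 := fun x => by
    rw [abs_of_nonneg (ruinTransform_nonneg hr x)]
    exact h.ruinTransform_le_one hm h₁ h₂ hb hr hr1 hδ x
  exact hf.defect_eq_zero hΦ1 hρ.1 fun v huv =>
    hf.exp_mul_defect_eq (h.measurable_ruinTransform hm h₁ h₂ hb hr hr1 hδ) hΦ1 hG hG1 hGeq hρ.1
      (hρ.rate_sub h₂) (hb.trans hu) huv fun z hz hzv => hI z v (hu.trans hz) hzv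

/-- The stretch `[0, b]` is bounded, so nothing forces the defect to vanish; `C` is its value at
`0`. -/
theorem IsRenewalModel.exists_ruinTransform_eq_of_le (hf : IsClaimDensity f)
    (h : IsRenewalModel P (expMeasure lam) (volume.withDensity fun x => ENNReal.ofReal (f x)) W X)
    (hlam : 0 < lam) (h₁ : 0 < c₁) (h₂ : 0 < c₂) (hb : 0 ≤ b) (hr : 0 ≤ r) (hr1 : r ≤ 1)
    (hδ : 0 < δ) {ρ : ℝ} (hρ : IsPositiveLundbergRoot c₁ lam δ r f ρ) :
    ∃ C, ∀ u, 0 ≤ u → u ≤ b → ruinTransform P W X b c₁ c₂ r δ u = C * Real.exp (ρ * u) +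
      lam * r / c₁ * (conv (ruinTransform P W X b c₁ c₂ r δ) (translationOp ρ f) u +
        translationOp ρ (tail f) u) := by
  obtain ⟨G, hG, hG1, hGeq, hI, -⟩ := h.exists_claim_average hf hlam h₁ h₂ hb hr hr1 hδ
  have hm := expMeasure_Iic_zero lam
  have hΦ1 : ∀ x, |ruinTransform P W X b c₁ c₂ r δ x| ≤ 1 := fun x => by
    rw [abs_of_nonneg (ruinTransform_nonneg hr x)]
    exact h.ruinTransform_le_one hm h₁ h₂ hb hr hr1 hδ x
  refine ⟨Real.exp (-ρ * 0) * (ruinTransform P W X b c₁ c₂ r δ 0 - lam * r / c₁ *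
    (conv (ruinTransform P W X b c₁ c₂ r δ) (translationOp ρ f) 0 + translationOp ρ (tail f) 0)),
    fun u hu hub => ?_⟩
  have key := hf.exp_mul_defect_eq (h.measurable_ruinTransform hm h₁ h₂ hb hr hr1 hδ) hΦ1 hG hG1
    hGeq hρ.1 (hρ.rate_sub h₁) le_rfl hu fun z hz hzu => hI z u hz hzu hub
  have hexp : Real.exp (ρ * u) * Real.exp (-ρ * u) = 1 := by rw [← Real.exp_add]; simp
  rw [← sub_eq_iff_eq_add, key, mul_right_comm, mul_comm (Real.exp (-ρ * u)), hexp, one_mul]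

/-- For equal premium rates the ruin transform is the series `phiInf`. -/
theorem IsRenewalModel.ruinTransform_self_eq (hf : IsClaimDensity f)
    (h : IsRenewalModel P (expMeasure lam) (volume.withDensity fun x => ENNReal.ofReal (f x)) W X)
    (hlam : 0 < lam) (h₁ : 0 < c₁) (hr : 0 ≤ r) (hr1 : r ≤ 1)
    (hδ : 0 < δ) {ρ : ℝ} (hρ : IsPositiveLundbergRoot c₁ lam δ r f ρ) {u : ℝ} (hu : 0 ≤ u) :
    ruinTransform P W X 0 c₁ c₁ r δ u = phiInf c₁ lam r ρ f u := by
  have hm := expMeasure_Iic_zero lam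
  -- With level `0` every starting capital `v ≥ 0` lies in the upper regime, hence `C = 0`.
  have := hf.eq_phiInf_add_nu (C := 0) hρ.1
    (h.measurable_ruinTransform hm h₁ h₁ le_rfl hr hr1 hδ) (fun x => by
      rw [abs_of_nonneg (ruinTransform_nonneg hr x)]
      exact h.ruinTransform_le_one hm h₁ h₁ le_rfl hr hr1 hδ x)
    (fun v hv _ => by
      rw [zero_mul, zero_add]
      exact h.ruinTransform_eq_of_ge hf hlam h₁ h₁ le_rfl hr hr1 hδ hρ hv) hu le_rfl
  rwa [zero_mul, add_zero] at this

/-- Below the refraction level the ruin transform is `phiInf` plus a multiple of `nu`. -/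
theorem IsRenewalModel.exists_ruinTransform_eq_add (hf : IsClaimDensity f)
    (h : IsRenewalModel P (expMeasure lam) (volume.withDensity fun x => ENNReal.ofReal (f x)) W X)
    (hlam : 0 < lam) (h₁ : 0 < c₁) (h₂ : 0 < c₂) (hb : 0 ≤ b) (hr : 0 ≤ r) (hr1 : r ≤ 1)
    (hδ : 0 < δ) {ρ : ℝ} (hρ : IsPositiveLundbergRoot c₁ lam δ r f ρ) :
    ∃ C, ∀ u, 0 ≤ u → u ≤ b → ruinTransform P W X b c₁ c₂ r δ u =
      phiInf c₁ lam r ρ f u + C * nu c₁ lam r ρ f u := by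
  have hm := expMeasure_Iic_zero lam
  obtain ⟨C, hC⟩ := h.exists_ruinTransform_eq_of_le hf hlam h₁ h₂ hb hr hr1 hδ hρ
  refine ⟨C, fun u hu hub => hf.eq_phiInf_add_nu hρ.1
    (h.measurable_ruinTransform hm h₁ h₂ hb hr hr1 hδ) (fun x => ?_) hC hu hub⟩
  rw [abs_of_nonneg (ruinTransform_nonneg hr x)]
  exact h.ruinTransform_le_one hm h₁ h₂ hb hr hr1 hδ x

/-- The ruin transform of the refracted process below the refraction level. -/
theorem IsRenewalModel.ruinTransform_refracted_eq (hf : IsClaimDensity f)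
    (h : IsRenewalModel P (expMeasure lam) (volume.withDensity fun x => ENNReal.ofReal (f x)) W X)
    (hlam : 0 < lam) (h₁ : 0 < c₁) (h₂ : 0 < c₂) (hb : 0 ≤ b) (hr : 0 ≤ r) (hr1 : r ≤ 1)
    (hδ : 0 < δ) {ρ₁ ρ₂ : ℝ} (hρ₁ : IsPositiveLundbergRoot c₁ lam δ r f ρ₁)
    (hρ₂ : IsPositiveLundbergRoot c₂ lam δ r f ρ₂) {u : ℝ} (hu : 0 ≤ u) (hub : u ≤ b) :
    ruinTransform P W X b c₁ c₂ r δ u = phiInf c₁ lam r ρ₁ f u +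
      (lam * r / c₂ * (conv (phiInf c₁ lam r ρ₁ f) (translationOp ρ₂ f) b +
        translationOp ρ₂ (tail f) b) - phiInf c₁ lam r ρ₁ f b) /
      (nu c₁ lam r ρ₁ f b - lam * r / c₂ * conv (nu c₁ lam r ρ₁ f) (translationOp ρ₂ f) b) *
      nu c₁ lam r ρ₁ f u := by
  obtain ⟨C, hC⟩ := h.exists_ruinTransform_eq_add hf hlam h₁ h₂ hb hr hr1 hδ hρ₁
  have hden := hf.denominator_pos h₁ h₂ hlam hr hr1 hδ hb hρ₁.1.le hρ₂
  -- The equation of the upper regime at `u = b` exactly, where the representation from below also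
  -- holds.
  have hb' := h.ruinTransform_eq_of_ge hf hlam h₁ h₂ hb hr hr1 hδ hρ₂ le_rfl
  have hKx : ContinuousOn (fun y => translationOp ρ₂ f (b - y)) (uIcc 0 b) := by
    have := hf.continuous_translationOp hρ₂.1.le
    fun_prop
  have hφ : ContinuousOn (phiInf c₁ lam r ρ₁ f) (uIcc 0 b) := by
    rw [uIcc_of_le hb]; exact hf.continuousOn_phiInf hρ₁.1 b
  have hν : ContinuousOn (nu c₁ lam r ρ₁ f) (uIcc 0 b) := by
    rw [uIcc_of_le hb]; exact hf.continuousOn_nu hρ₁.1.le b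
  -- The convolution at `b` involves `Φ` only on `[0, b]`, where its representation by `C` is
  -- available.
  have e : conv (ruinTransform P W X b c₁ c₂ r δ) (translationOp ρ₂ f) b =
      conv (phiInf c₁ lam r ρ₁ f) (translationOp ρ₂ f) b +
        C * conv (nu c₁ lam r ρ₁ f) (translationOp ρ₂ f) b := by
    simp only [conv]
    have i1 : IntervalIntegrable (fun y => phiInf c₁ lam r ρ₁ f y * translationOp ρ₂ f (b - y))
      volume 0 b := (hφ.mul hKx).intervalIntegrable
    have i2 : IntervalIntegrable (fun y => nu c₁ lam r ρ₁ f y * translationOp ρ₂ f (b - y))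
      volume 0 b := (hν.mul hKx).intervalIntegrable
    rw [← intervalIntegral.integral_const_mul, ← intervalIntegral.integral_add i1 (i2.const_mul C)]
    refine intervalIntegral.integral_congr fun y hy => ?_
    rw [uIcc_of_le hb] at hy
    simp only [hC y hy.1 hy.2]
    ring
  have hCeq : C = (lam * r / c₂ * (conv (phiInf c₁ lam r ρ₁ f) (translationOp ρ₂ f) b +
        translationOp ρ₂ (tail f) b) - phiInf c₁ lam r ρ₁ f b) /
      (nu c₁ lam r ρ₁ f b - lam * r / c₂ * conv (nu c₁ lam r ρ₁ f) (translationOp ρ₂ f) b) := by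
    rw [eq_div_iff hden.ne']
    rw [e, hC b hb le_rfl] at hb'
    linarith
  rw [hC u hu hub, ← hCeq]

end

end RiskModel

/-! ### Passage to measurable versions and conclusion -/

theorem mainTheorem4 {Ω : Type*} [MeasurableSpace Ω] (P : MeasureTheory.Measure Ω)
    [MeasureTheory.IsProbabilityMeasure P]
    (lam c₁ c₂ b r δ : ℝ) (hlam : 0 < lam) (hb : 0 < b) (hc : c₂ < c₁)
    (hr0 : 0 < r) (hr1 : r ≤ 1) (hδ : 0 < δ)
    -- the claim size density
    (f : ℝ → ℝ) (hf_meas : Measurable f) (hf_nonneg : ∀ x, 0 ≤ f x)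
    (hf_supp : ∀ x, x < 0 → f x = 0)
    -- inter-arrival times of a Poisson process of rate `lam`, and i.i.d. claims with density `f`
    (W X : ℕ → Ω → ℝ)
    (hW_law : ∀ i, ProbabilityTheory.HasLaw (W i) (ProbabilityTheory.expMeasure lam) P)
    (hX_law : ∀ i, ProbabilityTheory.HasLaw (X i)
      (MeasureTheory.volume.withDensity fun x => ENNReal.ofReal (f x)) P)
    (h_indep : ProbabilityTheory.iIndepFun (Sum.elim W X : ℕ ⊕ ℕ → Ω → ℝ) P)
    -- net profit condition
    (hX_int : MeasureTheory.Integrable (X 0) P) (h_profit : lam * (∫ ω, X 0 ω ∂P) < c₂)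
    (ρ₁ ρ₂ : ℝ) (hρ₁ : RiskModel.IsPositiveLundbergRoot c₁ lam δ r f ρ₁)
    (hρ₂ : RiskModel.IsPositiveLundbergRoot c₂ lam δ r f ρ₂) :
    let φInf : ℝ → ℝ := RiskModel.phiInf c₁ lam r ρ₁ f
    let ν : ℝ → ℝ := RiskModel.nu c₁ lam r ρ₁ f
    let T₂f : ℝ → ℝ := RiskModel.translationOp ρ₂ f
    let payoffInf : ℝ → Ω → ℝ := fun u ω => RiskModel.ruinDiscount r δ (fun i => W i ω)
      (RiskModel.classicalSurplus c₁ u (fun i => W i ω) (fun i => X i ω))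
    let payoff : ℝ → Ω → ℝ := fun u ω => RiskModel.ruinDiscount r δ (fun i => W i ω)
      (RiskModel.refractedSurplus b c₁ c₂ u (fun i => W i ω) (fun i => X i ω))
    (∀ u, 0 ≤ u → Summable (RiskModel.phiInfTerm c₁ lam r ρ₁ f u)) ∧
    (∀ u, 0 ≤ u → Summable (RiskModel.nuTerm c₁ lam r ρ₁ f u)) ∧
    (∀ u, 0 ≤ u → MeasureTheory.Integrable (payoffInf u) P ∧ ∫ ω, payoffInf u ω ∂P = φInf u) ∧
    ν b - lam * r / c₂ * RiskModel.conv ν T₂f b ≠ 0 ∧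
    (∀ u, 0 ≤ u → u ≤ b →
      MeasureTheory.Integrable (payoff u) P ∧
      ∫ ω, payoff u ω ∂P = φInf u +
        (lam * r / c₂ * (RiskModel.conv φInf T₂f b
            + RiskModel.translationOp ρ₂ (RiskModel.tail f) b) - φInf b) /
          (ν b - lam * r / c₂ * RiskModel.conv ν T₂f b) * ν u) := by
  intro φInf ν T₂f payoffInf payoff
  have : IsProbabilityMeasure (volume.withDensity fun x => ENNReal.ofReal (f x)) :=
    (hX_law 0).isProbabilityMeasure_iff.1 inferInstance
  have hf : RiskModel.IsClaimDensity f :=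
    RiskModel.isClaimDensity_of_isProbabilityMeasure hf_meas hf_nonneg hf_supp this
  have h₂ : 0 < c₂ := lt_of_le_of_lt
    (mul_nonneg hlam.le (RiskModel.integral_claim_nonneg hf (hX_law 0))) h_profit
  have h₁ : 0 < c₁ := h₂.trans hc
  obtain ⟨W', X', h, hae⟩ := RiskModel.exists_isRenewalModel hW_law hX_law h_indep
  have hm := RiskModel.expMeasure_Iic_zero lam
  refine ⟨fun u hu => hf.summable_phiInfTerm hρ₁.1 hu, fun u hu => hf.summable_nuTerm hρ₁.1.le hu,
    fun u hu => ?_, (hf.denominator_pos h₁ h₂ hlam hr0.le hr1 hδ hb.le hρ₁.1.le hρ₂).ne',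
    fun u hu hub => ?_⟩
  -- The classical path is treated as a refracted one with both rates `c₁` and level `0`.
  · have e : payoffInf u =ᵐ[P] fun ω => RiskModel.ruinDiscount r δ (fun i => W' i ω)
        (RiskModel.refractedSurplus 0 c₁ c₁ u (fun i => W' i ω) (fun i => X' i ω)) := by
      filter_upwards [hae, h.nonExplosive hm] with ω hω hne
      simp only [payoffInf]
      rw [hω.1, hω.2]
      exact RiskModel.ruinDiscount_congr fun t ht => hne.classicalSurplus_eq _ 0 h₁ u ht.le
    refine ⟨(h.integrable_ruinDiscount hm h₁ h₁ le_rfl hr0.le hr1 hδ u).congr e.symm, ?_⟩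
    rw [integral_congr_ae e]
    exact h.ruinTransform_self_eq hf hlam h₁ hr0.le hr1 hδ hρ₁ hu
  · have e : payoff u =ᵐ[P] fun ω => RiskModel.ruinDiscount r δ (fun i => W' i ω)
        (RiskModel.refractedSurplus b c₁ c₂ u (fun i => W' i ω) (fun i => X' i ω)) := by
      filter_upwards [hae] with ω hω
      simp only [payoff]
      rw [hω.1, hω.2]
    refine ⟨(h.integrable_ruinDiscount hm h₁ h₂ hb.le hr0.le hr1 hδ u).congr e.symm, ?_⟩
    rw [integral_congr_ae e]
    exact h.ruinTransform_refracted_eq hf hlam h₁ h₂ hb.le hr0.le hr1 hδ hρ₁ hρ₂ hu hub
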